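/- **Setting.** Let $X\neq\emptyset$ be a countable set and $b:X\times X\to[0,\infty)$ with $b(x,x)=0$, $b(x,y)=b(y,x)$ and $\sum_{z}b(x,z)<\infty$ for all $x,y\in X$ (a weighted graph; neither connectedness nor local finiteness is assumed). Let $\mathbb K\in\{\mathbb R,\mathbb C\}$; all functions and Hilbert spaces are over $\mathbb K$. Let $C_c(X)$ be the space of finitely supported functions. - A *weight* is a function $\mu:X\to(0,\infty)$; it is also viewed as the measure $\mu(A)=\sum_{x\in A}\mu(x)$, and $\mu$ is *finite* if $\mu(X)<\infty$. $\ell^2(X,\mu)$ is the Hilbert space with inner product $\langle f,g\rangle=\sum_x\overline{f(x)}g(x)\mu(x)$. - The formal operator $\mathcal H_\mu=\mathcal H_{\mu,0}$ (potential $V=0$) is $\mathcal H_\mu f(x)=\frac1{\mu(x)}\sum_y b(x,y)(f(x)-f(y))$ for $f\in\mathcal F=\{f:\sum_y b(x,y)|f(y)|<\infty\text{ for all }x\}$. - A self-adjoint operator $M$ on $\ell^2(X,\mu)$ is a *realization* of $\mathcal H_\mu$ if $M$ is bounded from below, the domain of the closed quadratic form associated with $M$ contains $C_c(X)$, and $D(M)\subseteq\mathcal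 F$ with $Mf=\mathcal H_\mu f$ for $f\in D(M)$. It is *Markovian* if its quadratic form $q$ is a Dirichlet form, i.e. $q\ge 0$ and for all $f\in D(q)$ and all $C:\mathbb K\to\mathbb K$ with $C(0)=0$ and $|C(s)-C(t)|\le|s-t|$ one has $C\circ f\in D(q)$ and $q(C\circ f)\le q(f)$. - $\mathcal Q(f)=\frac12\sum_{x,y}b(x,y)|f(x)-f(y)|^2$ and $\mathcal D=\{f:X\to\mathbb K:\mathcal Q(f)<\infty\}$. $\mathcal D^0$ is the set of $f\in\mathcal D$ for which there are $\varphi_n\in C_c(X)$ with $\varphi_n\to f$ pointwise and $\mathcal Q(f-\varphi_n)\to0$. - A metric $\rho$ on $X$ is *intrinsic* with respect to $b$ and $\mu$ if $\sum_y b(x,y)\rho(x,y)^2\le\mu(x)$ for all $x\in X$. - $(X,b,\mu)$ satisfies (FC) if for every $x\in X$ the function $y\mapsto b(x,y)/\mu(y)$ belongs to $\ell^2(X,\mu)$. In this case $H^{\min}_\mu$ is the restriction of $\mathcal H_\mu$ to $C_c(X)$, an operator in $\ell^2(X,\mu)$. **Theorem.** The following assertions are equivalent. 1. There exists a finite weight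 $\mu$ such that $\mathcal H_\mu$ has a unique Markovian realization. 2. For all finite weights $\mu$, $\mathcal H_\mu$ has a unique Markovian realization. 3. There exists a finite weight $\mu$ such that $\mathcal H_\mu$ has a unique realization. 4. There exist a finite weight $\mu$ and a metric $\rho$ on $X$ that is intrinsic with respect to $b$ and $\mu$ such that all $\rho$-balls $\{y:\rho(x,y)\le r\}$ are finite. 5. $1\in\mathcal D^0$ (recurrence). 6. There exists $f\in\mathcal D$ with $\lim_{x\to\infty}|f(x)|=\infty$, i.e. for every $R\in\mathbb R$ there is a finite $K\subseteq X$ with $|f(x)|\ge R$ for all $x\in X\setminus K$. 7. There exists a finite weight $\mu$ such that (FC) holds for $(X,b,\mu)$ and $H^{\min}_\mu$ is essentially self-adjoint on $\ell^2(X,\mu)$. -/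

import Mathlib

open MeasureTheory Filter Topology
open scoped ENNReal ComplexConjugate

noncomputable section

/-! ## Weighted graphs and weights -/

/-- A symmetric weighted graph on the vertex set `X`. -/
structure WeightedGraph (X : Type*) where
  b : X → X → ℝ
  nonneg : ∀ x y, 0 ≤ b x y
  diag : ∀ x, b x x = 0
  symm : ∀ x y, b x y = b y x
  summable : ∀ x, Summable (b x)

/-- A weight: a strictly positive function on `X`. -/
structure Weight (X : Type*) where
  toFun : X → ℝ
  pos : ∀ x, 0 < toFun x

instance {X : Type*} : CoeFun (Weight X) (fun _ => X → ℝ) := ⟨Weight.toFun⟩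

/-- The measure `A ↦ ∑_{x ∈ A} μ x` on all subsets of `X` induced by a weight. -/
def Weight.measure {X : Type*} (μ : Weight X) : @Measure X ⊤ :=
  @Measure.sum X X ⊤ (fun x => ENNReal.ofReal (μ x) • @Measure.dirac X ⊤ x)

/-- The weight is a finite measure, `μ(X) < ∞`. -/
def Weight.IsFinite {X : Type*} (μ : Weight X) : Prop := μ.measure Set.univ < ∞

/-- The Hilbert space `ℓ²(X, μ)`. Every point has positive measure, so that its elements are
functions on `X`. -/
abbrev Ell2 (𝕜 : Type*) [RCLike 𝕜] {X : Type*} (μ : Weight X) : Type _ := Lp 𝕜 2 μ.measure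

theorem Weight.ae_eq {X β : Type*} (μ : Weight X) {f g : X → β}
    (h : f =ᵐ[μ.measure] g) : f = g := by
  funext x
  by_contra hx
  have h0 : μ.measure {y | ¬ f y = g y} = 0 := ae_iff.mp h
  have h1 : μ.measure {x} = 0 := measure_mono_null (by simpa using hx) h0
  let _ : MeasurableSpace X := ⊤
  rw [Weight.measure, Measure.sum_apply _ (by trivial), ENNReal.tsum_eq_zero] at h1
  have h2 := h1 x
  have h3 : ¬ μ x ≤ 0 := not_le.mpr (μ.pos x)
  simp [h3] at h2

/-! ## Energy -/

section Energy

variable {𝕜 : Type*} [RCLike 𝕜] {X : Type*}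

/-- The energy `½ ∑_{x,y} b(x,y) |f x - f y|²` as an extended number. -/
def WeightedGraph.energy (G : WeightedGraph X) (f : X → 𝕜) : ℝ≥0∞ :=
  2⁻¹ * ∑' p : X × X, ENNReal.ofReal (G.b p.1 p.2 * ‖f p.1 - f p.2‖ ^ 2)

/-- The space `𝓓` of functions of finite energy (for the potential `V = 0`). -/
def WeightedGraph.FiniteEnergy (G : WeightedGraph X) : Set (X → 𝕜) := {f | G.energy f < ∞}

/-- The space `𝓓⁰`: functions of finite energy that are limits, pointwise and in energy, of a
sequence of finitely supported functions. -/
def WeightedGraph.FiniteEnergyZero (G : WeightedGraph X) : Set (X → 𝕜) :=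
  {f | f ∈ G.FiniteEnergy ∧ ∃ φ : ℕ → X → 𝕜, (∀ n, (Function.support (φ n)).Finite) ∧
    (∀ x, Tendsto (fun n => φ n x) atTop (𝓝 (f x))) ∧
    Tendsto (fun n => G.energy (f - φ n)) atTop (𝓝 0)}

/-- `f x → ∞` as `x → ∞`: outside suitable finite sets `|f|` is as large as one likes. -/
def TendsToInfinity (f : X → 𝕜) : Prop :=
  ∀ R : ℝ, ∃ K : Set X, K.Finite ∧ ∀ x, x ∉ K → R ≤ ‖f x‖

end Energy

/-! ## Intrinsic metrics -/

/-- The function `ρ` is intrinsic with respect to `b` and `μ`. -/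
def WeightedGraph.IsIntrinsic {X : Type*} (G : WeightedGraph X) (μ : Weight X)
    (ρ : X → X → ℝ) : Prop :=
  ∀ x, Summable (fun y => G.b x y * ρ x y ^ 2) ∧ ∑' y, G.b x y * ρ x y ^ 2 ≤ μ x

/-! ## The formal operator -/

section Formal

variable {𝕜 : Type*} [RCLike 𝕜] {X : Type*}

/-- The domain `𝓕` of the formal operator. -/
def WeightedGraph.formalDomain (G : WeightedGraph X) : Set (X → 𝕜) :=
  {f | ∀ x, Summable (fun y => G.b x y * ‖f y‖)}

/-- The formal operator `𝓗 = 𝓗_{μ,0}` with potential `V = 0`; it is only meaningful on `𝓕`. -/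
def WeightedGraph.formalOp (G : WeightedGraph X) (μ : Weight X) (f : X → 𝕜) (x : X) : 𝕜 :=
  ((μ x)⁻¹ : ℝ) • ∑' y, G.b x y • (f x - f y)

/-- The finiteness condition (FC): for every `x`, the function `y ↦ b(x,y) / μ(y)` belongs to
`ℓ²(X, μ)`. -/
def WeightedGraph.FC (G : WeightedGraph X) (μ : Weight X) : Prop :=
  ∀ x, MemLp (fun y => G.b x y / μ y) 2 μ.measure

/-- The finitely supported functions, as a subspace of `ℓ²(X, μ)`. -/
def finSupp (𝕜 : Type*) [RCLike 𝕜] {X : Type*} (μ : Weight X) : Submodule 𝕜 (Ell2 𝕜 μ) where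
  carrier := {f | (Function.support (f : X → 𝕜)).Finite}
  zero_mem' := by
    have h : ((0 : Ell2 𝕜 μ) : X → 𝕜) = 0 := μ.ae_eq (Lp.coeFn_zero 𝕜 2 μ.measure)
    change (Function.support ((0 : Ell2 𝕜 μ) : X → 𝕜)).Finite
    rw [h]
    simp
  add_mem' := by
    intro f g hf hg
    have h : ((f + g : Ell2 𝕜 μ) : X → 𝕜) = f + g := μ.ae_eq (Lp.coeFn_add f g)
    simp only [Set.mem_ofPred_eq, h] at hf hg ⊢
    exact (hf.union hg).subset (Function.support_add _ _)
  smul_mem' := by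
    intro c f hf
    have h : ((c • f : Ell2 𝕜 μ) : X → 𝕜) = c • (f : X → 𝕜) := μ.ae_eq (Lp.coeFn_smul c f)
    simp only [Set.mem_ofPred_eq, h] at hf ⊢
    exact hf.subset (Function.support_const_smul_subset c _)

theorem WeightedGraph.summable_of_finite_support (G : WeightedGraph X) {f : X → 𝕜}
    (hf : (Function.support f).Finite) (x : X) :
    Summable (fun y => G.b x y • (f x - f y)) := by
  have h1 : Summable (fun y => G.b x y • f x) := (G.summable x).smul_const _
  have h2 : Summable (fun y => G.b x y • f y) := by
    refine summable_of_hasFiniteSupport (hf.subset ?_)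
    intro y hy
    simp only [Function.mem_support] at hy ⊢
    exact fun h => hy (by simp [h])
  simpa [smul_sub] using h1.sub h2

theorem Weight.memLp_of_finite_support {E : Type*} [NormedAddCommGroup E] (μ : Weight X)
    {f : X → E} (hf : (Function.support f).Finite) : MemLp f 2 μ.measure := by
  classical
  let _ : MeasurableSpace X := ⊤
  have h : f = fun x => ∑ y ∈ hf.toFinset, Set.indicator {y} (fun _ => f y) x := by
    funext x
    by_cases hx : f x = 0
    · rw [hx, Finset.sum_eq_zero]
      intro y _
      by_cases hxy : x = y
      · subst hxy; simp [hx]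
      · simp [hxy]
    · rw [Finset.sum_eq_single x]
      · simp
      · intro y _ hy
        simp [Ne.symm hy]
      · intro h
        simp [hx] at h
  rw [h]
  refine memLp_finsetSum _ fun y _ => ?_
  refine memLp_indicator_const 2 (by trivial) _ (Or.inr ?_)
  rw [Weight.measure, Measure.sum_apply _ (by trivial), tsum_eq_single y]
  · simp
  · intro z hz
    simp [hz]

/-- Under (FC), `𝓗` maps finitely supported functions to `ℓ²(X, μ)`. -/
theorem WeightedGraph.FC.memLp_formalOp {G : WeightedGraph X} {μ : Weight X} (h : G.FC μ)
    {f : X → 𝕜} (hf : (Function.support f).Finite) :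
    MemLp (G.formalOp μ f) 2 μ.measure := by
  classical
  have key : G.formalOp μ f = (fun x => ((μ x)⁻¹ : ℝ) • (∑' y, G.b x y) • f x) -
      fun x => ∑ y ∈ hf.toFinset, (fun x => (G.b y x / μ x) • f y) x := by
    funext x
    have h1 : Summable (fun y => G.b x y • f x) := (G.summable x).smul_const _
    have h0 : ∀ y ∉ hf.toFinset, G.b x y • f y = 0 := by
      intro y hy
      have : f y = 0 := by simpa using hy
      simp [this]
    have h2 : Summable (fun y => G.b x y • f y) := summable_of_ne_finset_zero h0
    simp only [WeightedGraph.formalOp, Pi.sub_apply, smul_sub]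
    rw [h1.tsum_sub h2, smul_sub, (G.summable x).tsum_smul_const, tsum_eq_sum h0,
      Finset.smul_sum]
    congr 1
    refine Finset.sum_congr rfl fun y _ => ?_
    rw [smul_smul, G.symm x y]
    congr 1
    ring
  rw [key]
  refine MemLp.sub (μ.memLp_of_finite_support (hf.subset ?_)) (memLp_finsetSum _ fun y _ => ?_)
  · intro x hx
    simp only [Function.mem_support] at hx ⊢
    exact fun h => hx (by simp [h])
  · let _ : MeasurableSpace X := ⊤
    have hm : AEStronglyMeasurable (fun x => (G.b y x / μ x) • f y) μ.measure :=
      (h y).aestronglyMeasurable.smul_const (f y)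
    refine (h y).of_le_mul (c := ‖f y‖) hm (Eventually.of_forall fun x => ?_)
    simp [norm_smul, mul_comm]

/-- The minimal restriction `H^min` of `𝓗` under (FC): the restriction of `𝓗` to the finitely
supported functions. -/
def WeightedGraph.Hmin (𝕜 : Type*) [RCLike 𝕜] (G : WeightedGraph X) (μ : Weight X)
    (h : G.FC μ) : Ell2 𝕜 μ →ₗ.[𝕜] Ell2 𝕜 μ where
  domain := finSupp 𝕜 μ
  toFun :=
    { toFun := fun f => (h.memLp_formalOp (f := ((f : Ell2 𝕜 μ) : X → 𝕜)) f.2).toLp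
        (G.formalOp μ ((f : Ell2 𝕜 μ) : X → 𝕜))
      map_add' := by
        intro f g
        have e : (((f + g : finSupp 𝕜 μ) : Ell2 𝕜 μ) : X → 𝕜) =
            ((f : Ell2 𝕜 μ) : X → 𝕜) + ((g : Ell2 𝕜 μ) : X → 𝕜) :=
          μ.ae_eq (Lp.coeFn_add (f : Ell2 𝕜 μ) g)
        rw [← MemLp.toLp_add]
        refine MemLp.toLp_congr _ _ (Eventually.of_forall fun x => ?_)
        have hf := G.summable_of_finite_support f.2 x
        have hg := G.summable_of_finite_support g.2 x
        rw [e]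
        simp only [WeightedGraph.formalOp, Pi.add_apply]
        rw [← smul_add, ← hf.tsum_add hg]
        congr 1
        refine tsum_congr fun y => ?_
        rw [← smul_add]
        congr 1
        ring
      map_smul' := by
        intro c f
        have e : (((c • f : finSupp 𝕜 μ) : Ell2 𝕜 μ) : X → 𝕜) =
            c • ((f : Ell2 𝕜 μ) : X → 𝕜) :=
          μ.ae_eq (Lp.coeFn_smul c (f : Ell2 𝕜 μ))
        rw [RingHom.id_apply, ← MemLp.toLp_const_smul]
        refine MemLp.toLp_congr _ _ (Eventually.of_forall fun x => ?_)
        have hf := G.summable_of_finite_support f.2 x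
        rw [e]
        simp only [WeightedGraph.formalOp, Pi.smul_apply]
        rw [smul_comm c, ← hf.tsum_const_smul]
        congr 1
        refine tsum_congr fun y => ?_
        rw [← smul_sub, smul_comm] }

end Formal

/-! ## Closed quadratic forms and self-adjoint operators -/

section Forms

variable {𝕜 : Type*} [RCLike 𝕜] {H : Type*} [NormedAddCommGroup H] [InnerProductSpace 𝕜 H]

/-- A densely defined, lower semi-bounded, closed quadratic form on `H`, given by its domain and
its sesquilinear form (linear in the second argument). Convergence in the form norm is
convergence in `H` together with `q(u n - u m) → 0`, respectively `q(u n - f) → 0`. -/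
structure ClosedForm (𝕜 : Type*) [RCLike 𝕜] (H : Type*) [NormedAddCommGroup H]
    [InnerProductSpace 𝕜 H] where
  domain : Submodule 𝕜 H
  form : domain →ₗ⋆[𝕜] domain →ₗ[𝕜] 𝕜
  hermitian : ∀ f g, conj (form f g) = form g f
  dense : Dense (domain : Set H)
  lowerBounded : ∃ c : ℝ, ∀ f : domain, c * ‖(f : H)‖ ^ 2 ≤ RCLike.re (form f f)
  closed : ∀ u : ℕ → domain, CauchySeq (fun n => (u n : H)) →
    Tendsto (fun p : ℕ × ℕ => form (u p.1 - u p.2) (u p.1 - u p.2)) atTop (𝓝 0) →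
    ∃ f : domain, Tendsto (fun n => (u n : H)) atTop (𝓝 (f : H)) ∧
      Tendsto (fun n => form (u n - f) (u n - f)) atTop (𝓝 0)

/-- The value `q(f)` of a quadratic form on its domain. -/
def ClosedForm.quad (q : ClosedForm 𝕜 H) (f : q.domain) : ℝ := RCLike.re (q.form f f)

/-- `A` is the operator associated with the closed form `q` (equivalently, `q` is the form of
`A`): `f ∈ D(A)` with `A f = g` if and only if `f ∈ D(q)` and `q(f, h) = ⟨g, h⟩` for all
`h ∈ D(q)`. -/
def ClosedForm.IsFormOf (q : ClosedForm 𝕜 H) (A : H →ₗ.[𝕜] H) : Prop :=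
  ∀ f g : H, (f, g) ∈ A.graph ↔
    ∃ hf : f ∈ q.domain, ∀ h : q.domain, q.form ⟨f, hf⟩ h = inner 𝕜 g (h : H)

/-- `A` is semi-bounded from below. -/
def IsLowerSemibounded (A : H →ₗ.[𝕜] H) : Prop :=
  ∃ c : ℝ, ∀ f : A.domain, c * ‖(f : H)‖ ^ 2 ≤ RCLike.re (inner 𝕜 (f : H) (A f))

/-- `A` is essentially self-adjoint: it is closable and its closure is self-adjoint. -/
def IsEssSelfAdjoint [CompleteSpace H] (A : H →ₗ.[𝕜] H) : Prop :=
  A.IsClosable ∧ IsSelfAdjoint A.closure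

end Forms

/-! ## Realizations -/

section Realizations

variable {𝕜 : Type*} [RCLike 𝕜] {X : Type*}

/-- A self-adjoint operator `M` on `ℓ²(X, μ)` is a realization of `𝓗_{μ,0}`: it is semi-bounded
from below, the domain of its quadratic form contains the finitely supported functions, and it
is a restriction of `𝓗_{μ,0}`. -/
structure WeightedGraph.IsRealization (G : WeightedGraph X) (μ : Weight X)
    (M : Ell2 𝕜 μ →ₗ.[𝕜] Ell2 𝕜 μ) : Prop where
  selfAdjoint : IsSelfAdjoint M
  semibounded : IsLowerSemibounded M
  formDomain : ∃ q : ClosedForm 𝕜 (Ell2 𝕜 μ), q.IsFormOf M ∧ finSupp 𝕜 μ ≤ q.domain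
  formal : ∀ f : M.domain, ((f : Ell2 𝕜 μ) : X → 𝕜) ∈ G.formalDomain ∧
    ((M f : Ell2 𝕜 μ) : X → 𝕜) = G.formalOp μ ((f : Ell2 𝕜 μ) : X → 𝕜)

/-- A closed quadratic form on `ℓ²(X, μ)` is a Dirichlet form: it is nonnegative and normal
contractions operate on it without increasing its values. -/
def IsDirichletForm {μ : Weight X} (q : ClosedForm 𝕜 (Ell2 𝕜 μ)) : Prop :=
  (∀ f : q.domain, 0 ≤ q.quad f) ∧
  ∀ (C : 𝕜 → 𝕜) (hC : LipschitzWith 1 C) (hC0 : C 0 = 0) (f : q.domain),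
    ∃ h : hC.compLp hC0 (f : Ell2 𝕜 μ) ∈ q.domain, q.quad ⟨_, h⟩ ≤ q.quad f

/-- A realization is Markovian if its quadratic form is a Dirichlet form. -/
def WeightedGraph.IsMarkovianRealization (G : WeightedGraph X) (μ : Weight X)
    (M : Ell2 𝕜 μ →ₗ.[𝕜] Ell2 𝕜 μ) : Prop :=
  G.IsRealization μ M ∧ ∃ q : ClosedForm 𝕜 (Ell2 𝕜 μ), q.IsFormOf M ∧ IsDirichletForm q

end Realizations

end

/-! Condition 6 is the hub. Taking absolute values, it gives an exhaustion: `F ≥ 0` of finite energy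
with finite sublevel sets. Its cut-offs `max 0 (1 - F/(n+1))` are finitely supported, tend to 1
pointwise, and their energy is at most that of `F` divided by `(n+1)²`. So 5 follows at once.
Conversely, if `φ n` approximates 1, the sum of `|1 - φ n|` along a fast subsequence has finite
energy and tends to infinity. For 4, the distance to a fixed point in an intrinsic metric has energy
at most `μ(X)/2`; in the other direction `|F x - F y|`, slightly perturbed to separate points, is
intrinsic for a finite weight that dominates its energy density.

The analytic conditions are read off the normalized gradient, a closed operator from `ℓ²(X, μ)` to
`ℓ²(X × X)`, taken with its maximal domain (`grad`) or as the closure from finitely supported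
functions (`gradMin`). For both choices `T* T` is a Markovian realization. If `μ` is finite, the
constant 1 lies in the maximal domain and has gradient 0. If the two realizations coincide, 1 also
lies in the minimal domain, which is recurrence; this is 1 → 5.

Given an exhaustion and any weight, cut-offs and truncation show that the two domains agree
(`domain_grad_le`), and the Caccioppoli identity shows that a bounded `f` in `ℓ²` with `𝓗 f` in `ℓ²`
has finite energy (`finiteEnergy_of_bounded`). The resolvent of a Markovian realization preserves
bounds, so on preimages of finitely supported functions every such realization agrees with `T* T`;
by density it equals `T* T`. This gives 2.

For 7 the weight is chosen to dominate the energy density of `F`. The same identity then rules out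
nonzero solutions of `(𝓗 + 1) u = 0` in `ℓ²`. Under (FC) every realization extends `H^min`, so
essential self-adjointness leaves room for only one, which is 3. Since a Markovian realization
always exists, 3 implies 1. -/

/-! ## Nonnegative symmetric operators -/

namespace LinearPMap

section Operators

variable {𝕜 H K : Type*} [RCLike 𝕜] [NormedAddCommGroup H] [InnerProductSpace 𝕜 H]
  [NormedAddCommGroup K] [InnerProductSpace 𝕜 K]

/-- The operator `A` is symmetric, expressed through its graph. -/
def IsSymm (A : H →ₗ.[𝕜] H) : Prop :=
  ∀ ⦃p⦄, p ∈ A.graph → ∀ ⦃r⦄, r ∈ A.graph → inner 𝕜 p.2 r.1 = inner 𝕜 p.1 r.2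

/-- The operator `A` is nonnegative, expressed through its graph. -/
def IsNonneg (A : H →ₗ.[𝕜] H) : Prop :=
  ∀ ⦃p⦄, p ∈ A.graph → 0 ≤ RCLike.re (inner 𝕜 p.1 p.2)

/-- Cauchy–Schwarz for `‖f‖² ≤ Re ⟪f, A f + f⟫`. It makes `A + 1` injective with contractive
inverse. -/
theorem IsNonneg.norm_le {A : H →ₗ.[𝕜] H} (hA : A.IsNonneg) {p : H × H} (hp : p ∈ A.graph) :
    ‖p.1‖ ≤ ‖p.2 + p.1‖ := by
  have h1 : RCLike.re (inner 𝕜 p.1 (p.2 + p.1)) ≤ ‖p.1‖ * ‖p.2 + p.1‖ := re_inner_le_norm _ _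
  rw [inner_add_right, _root_.map_add, inner_self_eq_norm_sq] at h1
  have h2 := hA hp
  by_contra! h3
  have := norm_nonneg (p.2 + p.1)
  nlinarith

variable [CompleteSpace H]

/-- Density is automatic: a vector `A f + f` orthogonal to the domain is orthogonal to `f`, so `f =
0` by nonnegativity. For `(u, v)` in the adjoint, solve `A f + f = v + u`; by symmetry `u - f` is
orthogonal to the range of `A + 1`, which is everything. -/
theorem isSelfAdjoint_of_surjective {A : H →ₗ.[𝕜] H} (hs : A.IsSymm) (hn : A.IsNonneg)
    (h : ∀ u, ∃ p ∈ A.graph, p.2 + p.1 = u) : IsSelfAdjoint A := by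
  have hd : Dense (A.domain : Set H) := by
    rw [Submodule.dense_iff_topologicalClosure_eq_top, Submodule.topologicalClosure_eq_top_iff,
      Submodule.eq_bot_iff]
    intro u hu
    obtain ⟨p, hp, rfl⟩ := h u
    have h1 := (Submodule.mem_orthogonal _ _).mp hu p.1 (mem_domain_of_mem_graph hp)
    rw [inner_add_right] at h1
    have h2 := congrArg RCLike.re h1
    rw [_root_.map_add, inner_self_eq_norm_sq, _root_.map_zero] at h2
    have h3 := hn hp
    have h4 : p.1 = 0 := by
      rw [← norm_eq_zero]
      nlinarith [norm_nonneg p.1]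
    rw [A.graph_fst_eq_zero_snd hp h4, h4, add_zero]
  rw [isSelfAdjoint_def]
  apply eq_of_eq_graph
  rw [adjoint_graph_eq_graph_adjoint hd]
  ext ⟨u, v⟩
  rw [Submodule.mem_adjoint_iff]
  constructor
  · intro huv
    obtain ⟨p, hp, hpu⟩ := h (v + u)
    have key : u = p.1 := by
      refine ext_inner_left 𝕜 fun w => ?_
      obtain ⟨r, hr, rfl⟩ := h w
      have h1 := sub_eq_zero.mp (huv r.1 r.2 hr)
      have h2 := hs hr hp
      rw [inner_add_left, inner_add_left, h2, ← inner_add_right, hpu, inner_add_right, ← h1]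
    have key2 : v = p.2 := by
      rw [key] at hpu
      exact (add_right_cancel hpu).symm
    rw [key, key2]
    exact hp
  · intro hu a b hab
    rw [sub_eq_zero]
    exact hs hab hu

theorem isClosed_range_add_one {A : H →ₗ.[𝕜] H} (hc : A.IsClosed) (hn : A.IsNonneg) :
    _root_.IsClosed {u | ∃ p ∈ A.graph, p.2 + p.1 = u} := by
  refine isClosed_of_closure_subset fun u hu => ?_
  obtain ⟨v, hv, hvu⟩ := mem_closure_iff_seq_limit.mp hu
  choose p hp hpv using hv
  have h1 : CauchySeq fun n => (p n).1 := by
    have hcs := hvu.cauchySeq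
    rw [Metric.cauchySeq_iff'] at hcs ⊢
    intro ε hε
    obtain ⟨N, hN⟩ := hcs ε hε
    refine ⟨N, fun n hn' => lt_of_le_of_lt ?_ (hN n hn')⟩
    rw [dist_eq_norm, dist_eq_norm, ← hpv, ← hpv]
    have := hn.norm_le (A.graph.sub_mem (hp n) (hp N))
    refine this.trans (le_of_eq ?_)
    rw [Prod.fst_sub, Prod.snd_sub]
    congr 1
    abel
  obtain ⟨f, hf⟩ := cauchySeq_tendsto_of_complete h1
  have h2 : Tendsto (fun n => (p n).2) atTop (𝓝 (u - f)) := by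
    refine (hvu.sub hf).congr fun n => ?_
    rw [← hpv n, add_sub_cancel_right]
  exact ⟨(f, u - f), hc.mem_of_tendsto (hf.prodMk_nhds h2) (Eventually.of_forall hp),
    sub_add_cancel _ _⟩

theorem surjective_add_one {A : H →ₗ.[𝕜] H} (hc : A.IsClosed) (hn : A.IsNonneg)
    (h0 : ∀ u, (∀ p ∈ A.graph, inner 𝕜 (p.2 + p.1) u = 0) → u = 0) (u : H) :
    ∃ p ∈ A.graph, p.2 + p.1 = u := by
  let R : Submodule 𝕜 H := A.graph.map (LinearMap.snd 𝕜 H H + LinearMap.fst 𝕜 H H)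
  have hR : (R : Set H) = {u | ∃ p ∈ A.graph, p.2 + p.1 = u} := rfl
  have hcl : _root_.IsClosed (R : Set H) := hR ▸ isClosed_range_add_one hc hn
  have htop : R = ⊤ := by
    rw [← hcl.submodule_topologicalClosure_eq, Submodule.topologicalClosure_eq_top_iff,
      Submodule.eq_bot_iff]
    intro w hw
    refine h0 w fun p hp => ?_
    exact (Submodule.mem_orthogonal _ _).mp hw _ ⟨p, hp, rfl⟩
  have : u ∈ R := htop ▸ Submodule.mem_top
  exact this

theorem _root_.IsSelfAdjoint.mem_graph {A : H →ₗ.[𝕜] H} (hA : IsSelfAdjoint A) {p : H × H} :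
    p ∈ A.graph ↔ ∀ r ∈ A.graph, inner 𝕜 r.2 p.1 = inner 𝕜 r.1 p.2 := by
  have h := adjoint_graph_eq_graph_adjoint hA.dense_domain
  rw [isSelfAdjoint_def.mp hA] at h
  rw [h, Submodule.mem_adjoint_iff, ← h]
  simp only [sub_eq_zero, Prod.forall]

theorem _root_.IsSelfAdjoint.isSymm {A : H →ₗ.[𝕜] H} (hA : IsSelfAdjoint A) : A.IsSymm :=
  fun _ hp _ hr => hA.mem_graph.mp hr _ hp

/-- Self-adjoint operators have no proper symmetric extension: an element of the larger graph passes
the adjoint test against the smaller one. -/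
theorem _root_.IsSelfAdjoint.eq_of_le {A B : H →ₗ.[𝕜] H} (hA : IsSelfAdjoint A)
    (hB : IsSelfAdjoint B) (h : A ≤ B) : A = B := by
  have hg := le_graph_of_le h
  refine eq_of_eq_graph (le_antisymm hg fun p hp => ?_)
  exact hA.mem_graph.mpr fun r hr => hB.isSymm (hg hr) hp

theorem _root_.IsSelfAdjoint.surjective_add_one {A : H →ₗ.[𝕜] H} (hA : IsSelfAdjoint A)
    (hn : A.IsNonneg) (u : H) : ∃ p ∈ A.graph, p.2 + p.1 = u := by
  refine LinearPMap.surjective_add_one hA.isClosed hn (fun w hw => ?_) u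
  -- A vector orthogonal to the range of `A + 1` lies in the kernel of `A* + 1 = A + 1`, and
  -- nonnegativity kills it.
  have h1 : (w, -w) ∈ A.graph := hA.mem_graph.mpr fun r hr => by
    have := hw r hr
    rw [inner_add_left] at this
    rw [inner_neg_right]
    exact eq_neg_of_add_eq_zero_left this
  have h2 := hn h1
  rw [inner_neg_right, _root_.map_neg, inner_self_eq_norm_sq] at h2
  rw [← norm_eq_zero]
  nlinarith [norm_nonneg w]

/-- Symmetry and nonnegativity pass to the closure because they are closed conditions on the graph.
The closed operator then has closed range of `A + 1`, so triviality of the orthogonal complement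
gives surjectivity. -/
theorem isEssSelfAdjoint_of_range_dense {A : H →ₗ.[𝕜] H} (hd : Dense (A.domain : Set H))
    (hs : A.IsSymm) (hn : A.IsNonneg)
    (h0 : ∀ u, (∀ p ∈ A.graph, inner 𝕜 (p.2 + p.1) u = 0) → u = 0) : IsEssSelfAdjoint A := by
  have hle : A ≤ A.adjoint := le_of_le_graph fun p hp => by
    rw [adjoint_graph_eq_graph_adjoint hd, Submodule.mem_adjoint_iff]
    exact fun a b hab => sub_eq_zero.mpr (hs hab hp)
  have hcl : A.IsClosable := (adjoint_isClosed hd).isClosable.leIsClosable hle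
  have hg : (A.closure.graph : Set (H × H)) = _root_.closure A.graph := by
    rw [← hcl.graph_closure_eq_closure_graph, Submodule.topologicalClosure_coe]
  have hs' : A.closure.IsSymm := by
    intro p hp r hr
    have hp' : p ∈ _root_.closure (A.graph : Set (H × H)) := hg ▸ hp
    have hr' : r ∈ _root_.closure (A.graph : Set (H × H)) := hg ▸ hr
    have c1 : ∀ a ∈ A.graph, inner 𝕜 a.2 r.1 = inner 𝕜 a.1 r.2 := fun a ha =>
      closure_minimal (t := {r : H × H | inner 𝕜 a.2 r.1 = inner 𝕜 a.1 r.2})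
        (fun b hb => hs ha hb) (isClosed_eq (by fun_prop) (by fun_prop)) hr'
    exact closure_minimal (t := {p : H × H | inner 𝕜 p.2 r.1 = inner 𝕜 p.1 r.2})
        c1 (isClosed_eq (by fun_prop) (by fun_prop)) hp'
  have hn' : A.closure.IsNonneg := by
    intro p hp
    have hp' : p ∈ _root_.closure (A.graph : Set (H × H)) := hg ▸ hp
    exact closure_minimal (t := {p : H × H | 0 ≤ RCLike.re (inner 𝕜 p.1 p.2)})
        (fun b hb => hn hb) (isClosed_le (by fun_prop) (by fun_prop)) hp'
  refine ⟨hcl, isSelfAdjoint_of_surjective hs' hn' ?_⟩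
  refine surjective_add_one hcl.closure_isClosed hn' fun u hu => h0 u fun p hp => ?_
  exact hu p (le_graph_of_le A.le_closure hp)

end Operators

/-! ## The form and the operator of a closed operator between Hilbert spaces -/

section SquareForm

variable {𝕜 H K : Type*} [RCLike 𝕜] [NormedAddCommGroup H] [InnerProductSpace 𝕜 H]
  [NormedAddCommGroup K] [InnerProductSpace 𝕜 K]

/-- The closed form `(f, g) ↦ ⟪T f, T g⟫` of a closed densely defined operator `T`. -/
noncomputable def squareForm [CompleteSpace H] [CompleteSpace K] (T : H →ₗ.[𝕜] K)
    (hc : T.IsClosed) (hd : Dense (T.domain : Set H)) : ClosedForm 𝕜 H where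
  domain := T.domain
  form := LinearMap.mk₂'ₛₗ (starRingEnd 𝕜) (RingHom.id 𝕜) (fun f g => inner 𝕜 (T f) (T g))
    (fun _ _ _ => by rw [T.map_add, inner_add_left])
    (fun _ _ _ => by rw [T.map_smul, inner_smul_left]; rfl)
    (fun _ _ _ => by rw [T.map_add, inner_add_right])
    (fun _ _ _ => by rw [T.map_smul, inner_smul_right]; rfl)
  hermitian f g := inner_conj_symm _ _
  dense := hd
  lowerBounded := ⟨0, fun f => by
    rw [zero_mul]
    exact inner_self_nonneg⟩
  closed := by
    intro u hu hq
    have key : ∀ w : T.domain, inner 𝕜 (T w) (T w) = ((‖T w‖ ^ 2 : ℝ) : 𝕜) := fun w => by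
      rw [inner_self_eq_norm_sq_to_K]; norm_cast
    have hq' : Tendsto (fun p : ℕ × ℕ => ‖T (u p.1) - T (u p.2)‖ ^ 2) atTop (𝓝 0) := by
      have h1 := (RCLike.continuous_re.tendsto (0 : 𝕜)).comp hq
      rw [_root_.map_zero] at h1
      refine h1.congr fun p => ?_
      change RCLike.re (inner 𝕜 (T (u p.1 - u p.2)) (T (u p.1 - u p.2))) = _
      rw [inner_self_eq_norm_sq, T.map_sub]
    have hT : CauchySeq fun n => T (u n) := by
      rw [cauchySeq_iff_tendsto_dist_atTop_0]
      have h2 := (Real.continuous_sqrt.tendsto 0).comp hq'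
      rw [Real.sqrt_zero] at h2
      refine h2.congr fun p => ?_
      rw [Function.comp_apply, Real.sqrt_sq (norm_nonneg _), dist_eq_norm]
    obtain ⟨f, hf⟩ := cauchySeq_tendsto_of_complete hu
    obtain ⟨k, hk⟩ := cauchySeq_tendsto_of_complete hT
    have hmem : (f, k) ∈ T.graph :=
      hc.mem_of_tendsto (hf.prodMk_nhds hk) (Eventually.of_forall fun n => T.mem_graph (u n))
    obtain ⟨f', rfl, rfl⟩ := T.mem_graph_iff.mp hmem
    refine ⟨f', hf, ?_⟩
    have h3 : Tendsto (fun n => ((‖T (u n) - T f'‖ ^ 2 : ℝ) : 𝕜)) atTop (𝓝 0) := by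
      have h4 := ((RCLike.continuous_ofReal (K := 𝕜)).tendsto _).comp
        ((tendsto_iff_norm_sub_tendsto_zero.mp hk).pow 2)
      rwa [zero_pow two_ne_zero, RCLike.ofReal_zero] at h4
    refine h3.congr fun n => ?_
    change _ = inner 𝕜 (T (u n - f')) (T (u n - f'))
    rw [key, T.map_sub]

/-- The graph of the operator associated with the form `(f, g) ↦ ⟪T f, T g⟫`. -/
def squareGraph (T : H →ₗ.[𝕜] K) : Submodule 𝕜 (H × H) where
  carrier := {p | ∃ k, (p.1, k) ∈ T.graph ∧ ∀ r ∈ T.graph, inner 𝕜 k r.2 = inner 𝕜 p.2 r.1}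
  zero_mem' := ⟨0, T.graph.zero_mem, fun r _ => by simp⟩
  add_mem' := by
    rintro p p' ⟨k, hk, h⟩ ⟨k', hk', h'⟩
    refine ⟨k + k', T.graph.add_mem hk hk', fun r hr => ?_⟩
    rw [inner_add_left, h r hr, h' r hr, Prod.snd_add, inner_add_left]
  smul_mem' := by
    rintro c p ⟨k, hk, h⟩
    refine ⟨c • k, T.graph.smul_mem c hk, fun r hr => ?_⟩
    rw [inner_smul_left, h r hr, Prod.smul_snd, inner_smul_left]

/-- The operator `T* T`. -/
noncomputable def square (T : H →ₗ.[𝕜] K) : H →ₗ.[𝕜] H := T.squareGraph.toLinearPMap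

theorem graph_square {T : H →ₗ.[𝕜] K} (hd : Dense (T.domain : Set H)) :
    T.square.graph = T.squareGraph := by
  refine Submodule.toLinearPMap_graph_eq _ ?_
  rintro ⟨f, g⟩ ⟨k, hk, h⟩ hf
  change f = 0 at hf
  subst hf
  have hk0 : k = 0 := T.graph_fst_eq_zero_snd hk rfl
  refine hd.eq_zero_of_inner_left 𝕜 fun v hv => ?_
  have := h _ (T.mem_graph ⟨v, hv⟩)
  rw [hk0, inner_zero_left] at this
  exact this.symm

theorem squareForm_isFormOf [CompleteSpace H] [CompleteSpace K] {T : H →ₗ.[𝕜] K}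
    (hc : T.IsClosed) (hd : Dense (T.domain : Set H)) :
    (T.squareForm hc hd).IsFormOf T.square := by
  intro f g
  rw [graph_square hd]
  constructor
  · rintro ⟨k, hk, h⟩
    obtain ⟨f', rfl, rfl⟩ := T.mem_graph_iff.mp hk
    exact ⟨f'.2, fun r => h _ (T.mem_graph r)⟩
  · rintro ⟨hf, h⟩
    refine ⟨T ⟨f, hf⟩, T.mem_graph ⟨f, hf⟩, fun r hr => ?_⟩
    obtain ⟨r', h1, h2⟩ := T.mem_graph_iff.mp hr
    rw [← h1, ← h2]
    exact h r'

theorem square_isNonneg {T : H →ₗ.[𝕜] K} (hd : Dense (T.domain : Set H)) :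
    T.square.IsNonneg := by
  intro p hp
  rw [graph_square hd] at hp
  obtain ⟨k, hk, h⟩ := hp
  rw [← inner_conj_symm, RCLike.conj_re, ← h _ hk]
  exact inner_self_nonneg

/-- Von Neumann's argument. Project `(u, 0)` orthogonally onto the graph of `T`, obtaining `(f, T
f)`; orthogonality of the remainder `(u - f, -T f)` to the graph says exactly that `T* T f = u - f`.
-/
theorem square_isSelfAdjoint [CompleteSpace H] [CompleteSpace K] {T : H →ₗ.[𝕜] K}
    (hc : T.IsClosed) (hd : Dense (T.domain : Set H)) : IsSelfAdjoint T.square := by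
  refine isSelfAdjoint_of_surjective ?_ (square_isNonneg hd) ?_
  · intro p hp r hr
    rw [graph_square hd] at hp hr
    obtain ⟨k, hk, h⟩ := hp
    obtain ⟨l, hl, h'⟩ := hr
    rw [← h _ hl, ← inner_conj_symm, h' _ hk, inner_conj_symm]
  · intro u
    let Γ : Submodule 𝕜 (WithLp 2 (H × K)) :=
      T.graph.comap (WithLp.linearEquiv 2 𝕜 (H × K)).toLinearMap
    have hΓ : _root_.IsClosed (Γ : Set (WithLp 2 (H × K))) :=
      hc.preimage (WithLp.prod_continuous_ofLp 2 H K)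
    have : CompleteSpace Γ := hΓ.completeSpace_coe
    obtain ⟨y, hy, z, hz, hyz⟩ := Γ.exists_add_mem_mem_orthogonal (WithLp.toLp 2 (u, (0 : K)))
    refine ⟨(y.fst, u - y.fst), ?_, sub_add_cancel _ _⟩
    rw [graph_square hd]
    refine ⟨y.snd, hy, fun r hr => ?_⟩
    have h1 : inner 𝕜 z (WithLp.toLp 2 r) = 0 := Submodule.inner_left_of_mem_orthogonal hr hz
    rw [← sub_eq_of_eq_add' hyz, WithLp.prod_inner_apply] at h1
    have h2 : inner 𝕜 (u - y.fst) r.1 + inner 𝕜 (0 - y.snd) r.2 = 0 := h1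
    rw [zero_sub, inner_neg_left] at h2
    exact (add_neg_eq_zero.mp h2).symm

end SquareForm

end LinearPMap

/-! ## The space `ℓ²(X, μ)` -/

namespace Weight

variable {𝕜 : Type*} [RCLike 𝕜] {X : Type*} (μ : Weight X)

theorem lintegral_measure [Countable X] (f : X → ℝ≥0∞) :
    ∫⁻ x, f x ∂μ.measure = ∑' x, ENNReal.ofReal (μ x) * f x := by
  let _ : MeasurableSpace X := ⊤
  rw [Weight.measure, lintegral_sum_measure]
  refine tsum_congr fun x => ?_
  rw [lintegral_smul_measure, lintegral_dirac, smul_eq_mul]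

theorem isFinite_iff : μ.IsFinite ↔ Summable μ := by
  have h : μ.measure Set.univ = ∑' x, ENNReal.ofReal (μ x) := by
    let _ : MeasurableSpace X := ⊤
    rw [Weight.measure, Measure.sum_apply _ .univ]
    simp
  rw [IsFinite, h, lt_top_iff_ne_top]
  refine ⟨fun h => ?_, fun h => h.tsum_ofReal_ne_top⟩
  exact (ENNReal.summable_toReal h).congr fun x => ENNReal.toReal_ofReal (μ.pos x).le

theorem memLp_iff [Countable X] {E : Type*} [NormedAddCommGroup E] {f : X → E} :
    MemLp f 2 μ.measure ↔ Summable fun x => μ x * ‖f x‖ ^ 2 := by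
  have hm : @AEStronglyMeasurable _ _ _ ⊤ ⊤ f μ.measure := by
    let _ : MeasurableSpace X := ⊤
    exact StronglyMeasurable.of_discrete.aestronglyMeasurable
  have key : ∀ x, ENNReal.ofReal (μ x) * ‖f x‖ₑ ^ (2 : ℝ) = ENNReal.ofReal (μ x * ‖f x‖ ^ 2) := by
    intro x
    rw [ENNReal.ofReal_mul (μ.pos x).le, ← ofReal_norm, ENNReal.ofReal_pow (norm_nonneg _)]
    norm_cast
  have h : MemLp f 2 μ.measure ↔ ∑' x, ENNReal.ofReal (μ x * ‖f x‖ ^ 2) ≠ ∞ := by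
    rw [MemLp, eLpNorm_lt_top_iff_lintegral_rpow_enorm_lt_top two_ne_zero ENNReal.ofNat_ne_top,
      ENNReal.toReal_ofNat, lintegral_measure, tsum_congr key, lt_top_iff_ne_top]
    exact and_iff_right hm
  rw [h]
  refine ⟨fun h => ?_, fun h => h.tsum_ofReal_ne_top⟩
  exact (ENNReal.summable_toReal h).congr fun x =>
    ENNReal.toReal_ofReal (mul_nonneg (μ.pos x).le (sq_nonneg _))

variable {μ}

theorem ell2_ext {f g : Ell2 𝕜 μ} (h : ∀ x, (f : X → 𝕜) x = (g : X → 𝕜) x) : f = g :=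
  Lp.ext (Eventually.of_forall h)

theorem coe_zero : ((0 : Ell2 𝕜 μ) : X → 𝕜) = 0 := μ.ae_eq (Lp.coeFn_zero 𝕜 2 μ.measure)

theorem coe_add (f g : Ell2 𝕜 μ) : ((f + g : Ell2 𝕜 μ) : X → 𝕜) = f + g :=
  μ.ae_eq (Lp.coeFn_add f g)

theorem coe_sub (f g : Ell2 𝕜 μ) : ((f - g : Ell2 𝕜 μ) : X → 𝕜) = f - g :=
  μ.ae_eq (Lp.coeFn_sub f g)

theorem coe_smul (c : 𝕜) (f : Ell2 𝕜 μ) : ((c • f : Ell2 𝕜 μ) : X → 𝕜) = c • (f : X → 𝕜) :=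
  μ.ae_eq (Lp.coeFn_smul c f)

theorem coe_toLp {f : X → 𝕜} (h : MemLp f 2 μ.measure) : (h.toLp f : X → 𝕜) = f :=
  μ.ae_eq h.coeFn_toLp

theorem hasSum_inner [Countable X] (f g : Ell2 𝕜 μ) :
    HasSum (fun x => (μ x : 𝕜) * inner 𝕜 ((f : X → 𝕜) x) ((g : X → 𝕜) x)) (inner 𝕜 f g) := by
  let _ : MeasurableSpace X := ⊤
  rw [L2.inner_def]
  have h : Integrable (fun x => inner 𝕜 ((f : X → 𝕜) x) ((g : X → 𝕜) x)) μ.measure :=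
    L2.integrable_inner f g
  have h2 := hasSum_integral_measure h
  have e : ∀ x, ∫ y, inner 𝕜 ((f : X → 𝕜) y) ((g : X → 𝕜) y)
      ∂(ENNReal.ofReal (μ x) • Measure.dirac x) =
      (μ x : 𝕜) * inner 𝕜 ((f : X → 𝕜) x) ((g : X → 𝕜) x) := fun x => by
    rw [integral_smul_measure, integral_dirac, ENNReal.toReal_ofReal (μ.pos x).le,
      RCLike.real_smul_eq_coe_mul]
  simp only [e] at h2
  exact h2

theorem hasSum_norm_sq [Countable X] (f : Ell2 𝕜 μ) :
    HasSum (fun x => μ x * ‖(f : X → 𝕜) x‖ ^ 2) (‖f‖ ^ 2) := by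
  have h := RCLike.hasSum_re 𝕜 (hasSum_inner f f)
  rw [inner_self_eq_norm_sq] at h
  convert h using 2 with x
  rw [inner_self_eq_norm_sq_to_K]
  norm_cast

open Classical in
/-- The indicator function of a vertex, as an element of `ℓ²(X, μ)`. -/
noncomputable def delta (𝕜 : Type*) [RCLike 𝕜] (μ : Weight X) (x : X) : Ell2 𝕜 μ :=
  (μ.memLp_of_finite_support (f := Pi.single x (1 : 𝕜))
    ((Set.finite_singleton x).subset (Pi.support_single_subset))).toLp _

open Classical in
theorem coe_delta (x : X) : (delta 𝕜 μ x : X → 𝕜) = Pi.single x 1 := coe_toLp _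

/-- Point evaluations are continuous functionals; norm convergence therefore implies pointwise
convergence. -/
theorem inner_delta [Countable X] (x : X) (f : Ell2 𝕜 μ) :
    inner 𝕜 (delta 𝕜 μ x) f = μ x * (f : X → 𝕜) x := by
  classical
  refine (hasSum_inner _ f).unique ?_
  convert hasSum_single x fun y hy => ?_ using 1
  · simp [coe_delta]
  · simp [coe_delta, hy]

theorem tendsto_apply [Countable X] {ι : Type*} {l : Filter ι} {u : ι → Ell2 𝕜 μ} {f : Ell2 𝕜 μ}
    (h : Tendsto u l (𝓝 f)) (x : X) :
    Tendsto (fun n => (u n : X → 𝕜) x) l (𝓝 ((f : X → 𝕜) x)) := by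
  have h1 : Tendsto (fun n => inner 𝕜 (delta 𝕜 μ x) (u n)) l (𝓝 (inner 𝕜 (delta 𝕜 μ x) f)) :=
    tendsto_const_nhds.inner h
  simp only [inner_delta] at h1
  have h0 : (μ x : 𝕜) ≠ 0 := RCLike.ofReal_ne_zero.mpr (μ.pos x).ne'
  have h2 := h1.const_mul (μ x : 𝕜)⁻¹
  simpa only [inv_mul_cancel_left₀ h0] using h2

theorem mem_finSupp {f : Ell2 𝕜 μ} : f ∈ finSupp 𝕜 μ ↔ (Function.support (f : X → 𝕜)).Finite :=
  Iff.rfl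

theorem delta_mem_finSupp (x : X) : delta 𝕜 μ x ∈ finSupp 𝕜 μ := by
  classical
  rw [mem_finSupp, coe_delta]
  exact (Set.finite_singleton x).subset (Pi.support_single_subset)

theorem finSupp_eq_span : finSupp 𝕜 μ = Submodule.span 𝕜 (Set.range (delta 𝕜 μ)) := by
  classical
  refine le_antisymm (fun f hf => ?_) (Submodule.span_le.mpr ?_)
  · have h : f = ∑ x ∈ (mem_finSupp.mp hf).toFinset, (f : X → 𝕜) x • delta 𝕜 μ x := by
      have hc : ∀ s : Finset X, ((∑ x ∈ s, (f : X → 𝕜) x • delta 𝕜 μ x : Ell2 𝕜 μ) : X → 𝕜) =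
          ∑ x ∈ s, (f : X → 𝕜) x • Pi.single x (1 : 𝕜) := by
        intro s
        induction s using Finset.induction_on with
        | empty => simpa using coe_zero
        | insert a s ha ih => rw [Finset.sum_insert ha, Finset.sum_insert ha, coe_add, ih,
            coe_smul, coe_delta]
      refine ell2_ext fun y => ?_
      rw [hc, Finset.sum_apply]
      simp only [Pi.smul_apply, Pi.single_apply, smul_eq_mul, mul_ite, mul_one, mul_zero,
        Finset.sum_ite_eq, Set.Finite.mem_toFinset, Function.mem_support]
      by_cases hy : (f : X → 𝕜) y = 0 <;> simp [hy]
    rw [h]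
    exact Submodule.sum_mem _ fun x _ =>
      Submodule.smul_mem _ _ (Submodule.subset_span ⟨x, rfl⟩)
  · rintro _ ⟨x, rfl⟩
    exact delta_mem_finSupp x

theorem eq_zero_of_inner_delta [Countable X] {f : Ell2 𝕜 μ}
    (h : ∀ x, inner 𝕜 (delta 𝕜 μ x) f = 0) : f = 0 := by
  refine ell2_ext fun x => ?_
  have h1 := h x
  rw [inner_delta] at h1
  rw [coe_zero]
  exact (mul_eq_zero.mp h1).resolve_left (RCLike.ofReal_ne_zero.mpr (μ.pos x).ne')

theorem dense_finSupp [Countable X] : Dense (finSupp 𝕜 μ : Set (Ell2 𝕜 μ)) := by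
  rw [Submodule.dense_iff_topologicalClosure_eq_top, Submodule.topologicalClosure_eq_top_iff,
    Submodule.eq_bot_iff]
  intro f hf
  exact eq_zero_of_inner_delta fun x =>
    (Submodule.mem_orthogonal _ _).mp hf _ (delta_mem_finSupp x)

theorem coe_compLp {C : 𝕜 → 𝕜} (hC : LipschitzWith 1 C) (hC0 : C 0 = 0) (f : Ell2 𝕜 μ) :
    (hC.compLp hC0 f : X → 𝕜) = C ∘ f :=
  μ.ae_eq (hC.coeFn_compLp hC0 f)

end Weight

/-! ## The energy and the gradient -/

namespace WeightedGraph

section Gradient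

variable {𝕜 : Type*} [RCLike 𝕜] {X : Type*} (G : WeightedGraph X)

/-- The normalized gradient of `f`, a function on pairs of vertices. -/
noncomputable def gradFun (f : X → 𝕜) (p : X × X) : 𝕜 :=
  ((√(G.b p.1 p.2 / 2) : ℝ) : 𝕜) * (f p.1 - f p.2)

theorem norm_gradFun_sq (f : X → 𝕜) (p : X × X) :
    ‖G.gradFun f p‖ ^ 2 = G.b p.1 p.2 * ‖f p.1 - f p.2‖ ^ 2 / 2 := by
  rw [gradFun, norm_mul, mul_pow, RCLike.norm_ofReal, sq_abs,
    Real.sq_sqrt (div_nonneg (G.nonneg _ _) two_pos.le)]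
  ring

theorem energy_eq_tsum (f : X → 𝕜) :
    G.energy f = ∑' p, ENNReal.ofReal (‖G.gradFun f p‖ ^ 2) := by
  rw [energy, ← ENNReal.tsum_mul_left]
  refine tsum_congr fun p => ?_
  rw [norm_gradFun_sq, ENNReal.ofReal_div_of_pos two_pos, ENNReal.ofReal_ofNat, mul_comm,
    div_eq_mul_inv]

theorem mem_finiteEnergy_iff {f : X → 𝕜} :
    f ∈ G.FiniteEnergy ↔ Summable fun p : X × X => G.b p.1 p.2 * ‖f p.1 - f p.2‖ ^ 2 := by
  have h : Summable (fun p : X × X => G.b p.1 p.2 * ‖f p.1 - f p.2‖ ^ 2) ↔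
      Summable fun p => ‖G.gradFun f p‖ ^ 2 := by
    simp only [norm_gradFun_sq]
    exact (summable_div_const_iff two_ne_zero).symm
  rw [h, FiniteEnergy, Set.mem_ofPred_eq, energy_eq_tsum, lt_top_iff_ne_top]
  refine ⟨fun h => ?_, fun h => h.tsum_ofReal_ne_top⟩
  exact (ENNReal.summable_toReal h).congr fun x => ENNReal.toReal_ofReal (sq_nonneg _)

theorem memℓp_gradFun_iff {f : X → 𝕜} :
    Memℓp (G.gradFun f) 2 ↔ f ∈ G.FiniteEnergy := by
  rw [memℓp_gen_iff (by norm_num), mem_finiteEnergy_iff]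
  simp only [ENNReal.toReal_ofNat, Real.rpow_two, norm_gradFun_sq]
  exact summable_div_const_iff two_ne_zero

theorem gradFun_add (f g : X → 𝕜) : G.gradFun (f + g) = G.gradFun f + G.gradFun g := by
  funext p
  simp only [gradFun, Pi.add_apply]
  ring

theorem gradFun_smul (c : 𝕜) (f : X → 𝕜) : G.gradFun (c • f) = c • G.gradFun f := by
  funext p
  simp only [gradFun, Pi.smul_apply, smul_eq_mul]
  ring

theorem gradFun_zero : G.gradFun (0 : X → 𝕜) = 0 := by
  funext p
  simp [gradFun]

theorem gradFun_one : G.gradFun (fun _ => 1 : X → 𝕜) = 0 := by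
  funext p
  simp [gradFun]

theorem norm_gradFun_comp_le {C : 𝕜 → 𝕜} (hC : LipschitzWith 1 C) (f : X → 𝕜) (p : X × X) :
    ‖G.gradFun (C ∘ f) p‖ ≤ ‖G.gradFun f p‖ := by
  rw [gradFun, gradFun, norm_mul, norm_mul]
  refine mul_le_mul_of_nonneg_left ?_ (norm_nonneg _)
  simpa using hC.norm_sub_le (f p.1) (f p.2)

/-- The unweighted formal Laplacian. -/
noncomputable def lap (f : X → 𝕜) (x : X) : 𝕜 := ∑' y, G.b x y • (f x - f y)

theorem formalOp_eq (μ : Weight X) (f : X → 𝕜) (x : X) :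
    G.formalOp μ f x = (μ x : 𝕜)⁻¹ * G.lap f x := by
  rw [formalOp, RCLike.real_smul_eq_coe_mul, RCLike.ofReal_inv]
  rfl

theorem coe_mul_formalOp (μ : Weight X) (f : X → 𝕜) (x : X) :
    (μ x : 𝕜) * G.formalOp μ f x = G.lap f x := by
  rw [formalOp_eq, mul_inv_cancel_left₀ (RCLike.ofReal_ne_zero.mpr (μ.pos x).ne')]

variable {G}

theorem hasSum_lap {f : X → 𝕜} (hf : f ∈ G.formalDomain) (x : X) :
    HasSum (fun y => G.b x y • (f x - f y)) (G.lap f x) := by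
  refine Summable.hasSum ?_
  have h1 : Summable fun y => G.b x y • f x := (G.summable x).smul_const _
  have h2 : Summable fun y => G.b x y • f y := by
    refine Summable.of_norm ((hf x).congr fun y => ?_)
    rw [norm_smul, Real.norm_of_nonneg (G.nonneg x y)]
  simpa only [smul_sub] using h1.sub h2

theorem finiteEnergy_subset_formalDomain {f : X → 𝕜} (hf : f ∈ G.FiniteEnergy) :
    f ∈ G.formalDomain := by
  intro x
  have h1 : Summable fun y => G.b x y * ‖f x - f y‖ ^ 2 :=
    ((G.mem_finiteEnergy_iff.mp hf).prod_factor x)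
  -- The majorant comes from `|f y| ≤ |f x| + |f x - f y|` and `t ≤ 1 + t²`.
  have h2 := ((G.summable x).mul_right (1 + ‖f x‖)).add h1
  refine Summable.of_nonneg_of_le (fun y => mul_nonneg (G.nonneg x y) (norm_nonneg _))
    (fun y => ?_) h2
  rw [← mul_add]
  refine mul_le_mul_of_nonneg_left ?_ (G.nonneg x y)
  have h3 := norm_sub_norm_le (f y) (f x)
  rw [norm_sub_rev] at h3
  nlinarith [sq_nonneg (‖f x - f y‖ - 1)]

open Classical in
-- Green's formula for an indicator function. Only the pairs with an endpoint at `z` contribute;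
-- each edge occurs in both orientations, with weight one half from the normalization of the
-- gradient.
theorem hasSum_gradFun_single {f : X → 𝕜} (hf : f ∈ G.formalDomain) (z : X) :
    HasSum (fun p => inner 𝕜 (G.gradFun (Pi.single z 1) p) (G.gradFun f p)) (G.lap f z) := by
  have h0 : HasSum (fun p : X × X =>
      (if p.1 = z then (2⁻¹ : 𝕜) * G.b p.1 p.2 • (f p.1 - f p.2) else 0)) (2⁻¹ * G.lap f z) := by
    have hi : Function.Injective fun y : X => (z, y) := fun a b h => (Prod.ext_iff.mp h).2
    rw [← hi.hasSum_iff]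
    · simpa [Function.comp_def] using (hasSum_lap hf z).mul_left (2⁻¹ : 𝕜)
    · rintro ⟨x, y⟩ h
      rw [if_neg]
      rintro rfl
      exact h ⟨y, rfl⟩
  have h1 := h0.add ((Equiv.prodComm X X).hasSum_iff.mpr h0)
  have e : 2⁻¹ * G.lap f z + 2⁻¹ * G.lap f z = G.lap f z := by ring
  rw [e] at h1
  convert h1 using 2 with p
  obtain ⟨x, y⟩ := p
  have hs : (((√(G.b x y / 2) : ℝ) : 𝕜)) * ((√(G.b x y / 2) : ℝ) : 𝕜) = 2⁻¹ * (G.b x y : 𝕜) := by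
    rw [← RCLike.ofReal_mul, Real.mul_self_sqrt (div_nonneg (G.nonneg _ _) two_pos.le)]
    push_cast
    ring
  simp only [gradFun, RCLike.inner_apply, Function.comp_apply, Equiv.prodComm_apply,
    Prod.swap_prod_mk, G.symm y x, map_mul, map_sub, RCLike.conj_ofReal, Pi.single_apply,
    RCLike.real_smul_eq_coe_mul]
  by_cases hx : x = z
  · by_cases hy : y = z
    · simp [hx, hy]
    · simp only [hx, hy, if_true, if_false, map_one, map_zero]
      rw [hx] at hs
      linear_combination (f z - f y) * hs
  · by_cases hy : y = z
    · simp only [hx, hy, if_true, if_false, map_one, map_zero]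
      rw [hy] at hs
      linear_combination (f z - f x) * hs
    · simp [hx, hy]

variable (𝕜 G) (μ : Weight X)

/-- The gradient with its maximal domain in `ℓ²(X, μ)`. -/
noncomputable def grad : Ell2 𝕜 μ →ₗ.[𝕜] lp (fun _ : X × X => 𝕜) 2 where
  domain :=
    { carrier := {f | (f : X → 𝕜) ∈ G.FiniteEnergy}
      zero_mem' := by
        rw [Set.mem_ofPred_eq, ← memℓp_gradFun_iff, Weight.coe_zero, gradFun_zero]
        exact zero_memℓp
      add_mem' := fun {f g} hf hg => by
        rw [Set.mem_ofPred_eq, ← memℓp_gradFun_iff] at *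
        rw [Weight.coe_add, gradFun_add]
        exact hf.add hg
      smul_mem' := fun c f hf => by
        rw [Set.mem_ofPred_eq, ← memℓp_gradFun_iff] at *
        rw [Weight.coe_smul, gradFun_smul]
        exact hf.const_smul c }
  toFun :=
    { toFun := fun f => ⟨G.gradFun (f : Ell2 𝕜 μ), G.memℓp_gradFun_iff.mpr f.2⟩
      map_add' := fun f g => Subtype.ext <| by
        change G.gradFun ((f + g : Ell2 𝕜 μ) : X → 𝕜) = _
        rw [Weight.coe_add, gradFun_add]
        rfl
      map_smul' := fun c f => Subtype.ext <| by
        change G.gradFun ((c • f : Ell2 𝕜 μ) : X → 𝕜) = _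
        rw [Weight.coe_smul, gradFun_smul]
        rfl }

variable {𝕜 G μ}

theorem mem_graph_grad {f : Ell2 𝕜 μ} {k : lp (fun _ : X × X => 𝕜) 2} :
    (f, k) ∈ (G.grad 𝕜 μ).graph ↔ ⇑k = G.gradFun (f : X → 𝕜) := by
  rw [LinearPMap.mem_graph_iff]
  constructor
  · rintro ⟨f', rfl, rfl⟩
    rfl
  · intro h
    have hf : (f : X → 𝕜) ∈ G.FiniteEnergy := by
      rw [← memℓp_gradFun_iff, ← h]
      exact lp.memℓp k
    exact ⟨⟨f, hf⟩, rfl, Subtype.ext h.symm⟩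

theorem mem_domain_grad {f : Ell2 𝕜 μ} :
    f ∈ (G.grad 𝕜 μ).domain ↔ (f : X → 𝕜) ∈ G.FiniteEnergy := Iff.rfl

theorem grad_apply (f : (G.grad 𝕜 μ).domain) :
    ⇑(G.grad 𝕜 μ f) = G.gradFun ((f : Ell2 𝕜 μ) : X → 𝕜) := rfl

theorem tendsto_gradFun {ι : Type*} {l : Filter ι} {u : ι → X → 𝕜} {f : X → 𝕜}
    (h : ∀ x, Tendsto (fun n => u n x) l (𝓝 (f x))) (p : X × X) :
    Tendsto (fun n => G.gradFun (u n) p) l (𝓝 (G.gradFun f p)) :=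
  ((h p.1).sub (h p.2)).const_mul _

/-- Convergence in both `ℓ²` spaces is pointwise, and the gradient at a pair involves only two
values. -/
theorem isClosed_grad [Countable X] : (G.grad 𝕜 μ).IsClosed := by
  refine isClosed_of_closure_subset fun p hp => ?_
  obtain ⟨u, hu, hup⟩ := mem_closure_iff_seq_limit.mp hp
  obtain ⟨f, k⟩ := p
  refine mem_graph_grad.mpr (funext fun q => ?_)
  have h1 : Tendsto (fun n => (u n).2 q) atTop (𝓝 (k q)) := by
    have h3 : Tendsto (fun n => ((u n).2 : X × X → 𝕜)) atTop (𝓝 k) :=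
      (lp.uniformContinuous_coe.continuous.tendsto k).comp ((continuous_snd.tendsto _).comp hup)
    exact tendsto_pi_nhds.mp h3 q
  have h2 := tendsto_gradFun (G := G)
    (fun x => Weight.tendsto_apply ((continuous_fst.tendsto _).comp hup) x) q
  refine tendsto_nhds_unique (h1.congr fun n => ?_) h2
  exact congrFun (mem_graph_grad.mp (hu n)) q

theorem inner_grad_delta {z : X} {f : Ell2 𝕜 μ} {k l : lp (fun _ : X × X => 𝕜) 2}
    (hl : (Weight.delta 𝕜 μ z, l) ∈ (G.grad 𝕜 μ).graph) (hk : (f, k) ∈ (G.grad 𝕜 μ).graph) :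
    inner 𝕜 l k = G.lap (f : X → 𝕜) z := by
  classical
  have h := lp.hasSum_inner (𝕜 := 𝕜) l k
  rw [mem_graph_grad.mp hl, mem_graph_grad.mp hk, Weight.coe_delta] at h
  refine h.unique (hasSum_gradFun_single (finiteEnergy_subset_formalDomain ?_) z)
  exact LinearPMap.mem_domain_of_mem_graph hk

theorem energy_eq_ofReal_norm_sq {f : X → 𝕜} {k : lp (fun _ : X × X => 𝕜) 2}
    (hk : ⇑k = G.gradFun f) : G.energy f = ENNReal.ofReal (‖k‖ ^ 2) := by
  have h := lp.hasSum_norm (p := 2) (by norm_num) k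
  simp only [ENNReal.toReal_ofNat, Real.rpow_two] at h
  rw [energy_eq_tsum, ← hk, ← h.tsum_eq,
    ENNReal.ofReal_tsum_of_nonneg (fun p => sq_nonneg _) h.summable]

theorem ofReal_norm_sq_eq_energy {f : Ell2 𝕜 μ} {k : lp (fun _ : X × X => 𝕜) 2}
    (hk : (f, k) ∈ (G.grad 𝕜 μ).graph) :
    ENNReal.ofReal (‖k‖ ^ 2) = G.energy (f : X → 𝕜) :=
  (energy_eq_ofReal_norm_sq (mem_graph_grad.mp hk)).symm

/-- Fatou's lemma for the energy, by passing to the limit in finite partial sums. -/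
theorem energy_le_of_tendsto {u : ℕ → X → 𝕜} {f : X → 𝕜} {C : ℝ≥0∞}
    (h : ∀ x, Tendsto (fun n => u n x) atTop (𝓝 (f x))) (hC : ∀ n, G.energy (u n) ≤ C) :
    G.energy f ≤ C := by
  rw [energy_eq_tsum]
  refine ENNReal.summable.tsum_le_of_sum_le fun s => ?_
  have h1 : Tendsto (fun n => ∑ p ∈ s, ENNReal.ofReal (‖G.gradFun (u n) p‖ ^ 2)) atTop
      (𝓝 (∑ p ∈ s, ENNReal.ofReal (‖G.gradFun f p‖ ^ 2))) :=
    tendsto_finsetSum _ fun p _ => ENNReal.tendsto_ofReal ((tendsto_gradFun h p).norm.pow 2)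
  refine le_of_tendsto h1 (Eventually.of_forall fun n => le_trans ?_ (hC n))
  rw [energy_eq_tsum]
  exact ENNReal.sum_le_tsum s

end Gradient

end WeightedGraph

/-! ## Weak limits of bounded sequences -/

section WeakLimits

variable {𝕜 E : Type*} [RCLike 𝕜] [NormedAddCommGroup E] [InnerProductSpace 𝕜 E] [CompleteSpace E]

theorem tendsto_inner_zero_of_norm_le {y : ℕ → E} {C : ℝ} (hC : ∀ n, ‖y n‖ ≤ C) {S : Set E}
    (hS : ∀ z, (∀ s ∈ S, inner 𝕜 s z = 0) → z = 0)
    (h : ∀ s ∈ S, Tendsto (fun n => inner 𝕜 s (y n)) atTop (𝓝 0)) (v : E) :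
    Tendsto (fun n => inner 𝕜 v (y n)) atTop (𝓝 0) := by
  let M : Submodule 𝕜 E :=
    { carrier := {v | Tendsto (fun n => inner 𝕜 v (y n)) atTop (𝓝 0)}
      zero_mem' := by simp
      add_mem' := fun {a b} ha hb => by
        simpa [inner_add_left] using Tendsto.add ha hb
      smul_mem' := fun c a ha => by
        simpa [inner_smul_left] using Tendsto.const_mul (conj c) ha }
  have hM : M.topologicalClosure = ⊤ := by
    rw [Submodule.topologicalClosure_eq_top_iff, Submodule.eq_bot_iff]
    exact fun z hz => hS z fun s hs => (Submodule.mem_orthogonal _ _).mp hz s (h s hs)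
  have hv : v ∈ closure (M : Set E) := by
    rw [← Submodule.topologicalClosure_coe, hM]
    trivial
  have hC0 : 0 ≤ C := (norm_nonneg _).trans (hC 0)
  rw [Metric.tendsto_atTop]
  intro ε hε
  obtain ⟨s, hs, hvs⟩ := Metric.mem_closure_iff.mp hv (ε / 2 / (C + 1)) (by positivity)
  obtain ⟨N, hN⟩ := Metric.tendsto_atTop.mp (show Tendsto _ _ _ from hs) (ε / 2) (by positivity)
  refine ⟨N, fun n hn => ?_⟩
  have h1 := hN n hn
  rw [dist_zero_right] at h1 ⊢
  have h2 : ‖inner 𝕜 (v - s) (y n)‖ ≤ ε / 2 := by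
    refine (norm_inner_le_norm _ _).trans ?_
    rw [dist_eq_norm] at hvs
    calc ‖v - s‖ * ‖y n‖ ≤ ε / 2 / (C + 1) * (C + 1) :=
          mul_le_mul hvs.le ((hC n).trans (by linarith)) (norm_nonneg _) (by positivity)
      _ = ε / 2 := div_mul_cancel₀ _ (by positivity)
  have h3 : inner 𝕜 v (y n) = inner 𝕜 (v - s) (y n) + inner 𝕜 s (y n) := by
    rw [← inner_add_left, sub_add_cancel]
  rw [h3]
  exact (norm_add_le _ _).trans_lt (by linarith)

/-- Closed subspaces are weakly closed, and for bounded sequences weak convergence need only be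
tested on a total set. The component `z` of the limit orthogonal to `V` satisfies `⟪z, u n - w⟫ =
-‖z‖²` for all `n`, yet this tends to 0. -/
theorem mem_of_tendsto_inner_of_norm_le {V : Submodule 𝕜 E} (hV : IsClosed (V : Set E))
    {u : ℕ → E} (hu : ∀ n, u n ∈ V) {w : E} {C : ℝ} (hC : ∀ n, ‖u n‖ ≤ C) {S : Set E}
    (hS : ∀ z, (∀ s ∈ S, inner 𝕜 s z = 0) → z = 0)
    (h : ∀ s ∈ S, Tendsto (fun n => inner 𝕜 s (u n)) atTop (𝓝 (inner 𝕜 s w))) : w ∈ V := by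
  have : CompleteSpace V := hV.completeSpace_coe
  obtain ⟨a, ha, z, hz, rfl⟩ := V.exists_add_mem_mem_orthogonal w
  have h1 := tendsto_inner_zero_of_norm_le (𝕜 := 𝕜) (y := fun n => u n - (a + z))
    (C := C + ‖a + z‖) (fun n => (norm_sub_le _ _).trans (by gcongr; exact hC n)) hS
    (fun s hs => by
      simpa only [inner_sub_right, sub_self] using (h s hs).sub_const (inner 𝕜 s (a + z))) z
  have h2 : ∀ n, inner 𝕜 z (u n - (a + z)) = -inner 𝕜 z z := fun n => by
    rw [inner_sub_right, inner_add_right, Submodule.inner_left_of_mem_orthogonal (hu n) hz,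
      Submodule.inner_left_of_mem_orthogonal ha hz]
    ring
  simp only [h2] at h1
  have h3 := tendsto_nhds_unique h1 tendsto_const_nhds
  have h4 : z = 0 := by
    rw [← inner_self_eq_zero (𝕜 := 𝕜)]
    exact neg_eq_zero.mp h3.symm
  rw [h4, add_zero]
  exact ha

end WeakLimits

/-! ## The minimal gradient -/

namespace WeightedGraph

section MinimalGradient

variable {𝕜 : Type*} [RCLike 𝕜] {X : Type*} {G : WeightedGraph X} {μ : Weight X}

theorem finiteEnergy_of_finite_support {f : X → 𝕜} (hf : (Function.support f).Finite) :
    f ∈ G.FiniteEnergy := by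
  rw [mem_finiteEnergy_iff]
  have h1 : Summable fun p : X × X => G.b p.1 p.2 * ‖f p.1‖ ^ 2 := by
    refine (summable_prod_of_nonneg fun p => ?_).mpr
      ⟨fun x => (G.summable x).mul_right (‖f x‖ ^ 2), ?_⟩
    · exact mul_nonneg (G.nonneg p.1 p.2) (sq_nonneg ‖f p.1‖)
    · refine summable_of_ne_finset_zero (s := hf.toFinset) fun x hx => ?_
      have hfx : f x = 0 := by simpa using hx
      simp [hfx]
  have h2 := (Equiv.prodComm X X).summable_iff.mpr h1
  refine Summable.of_nonneg_of_le
    (fun p => mul_nonneg (G.nonneg p.1 p.2) (sq_nonneg ‖f p.1 - f p.2‖)) (fun p => ?_)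
    ((h1.add h2).mul_left 2)
  simp only [Function.comp_apply, Equiv.prodComm_apply, Prod.fst_swap, Prod.snd_swap]
  rw [G.symm p.2 p.1, ← mul_add, mul_left_comm]
  refine mul_le_mul_of_nonneg_left ?_ (G.nonneg _ _)
  have h3 := norm_sub_le (f p.1) (f p.2)
  have h4 := norm_nonneg (f p.1 - f p.2)
  nlinarith [sq_nonneg (‖f p.1‖ - ‖f p.2‖)]

variable (𝕜 G μ)

/-- The closure of the gradient on finitely supported functions. -/
noncomputable def gradMin : Ell2 𝕜 μ →ₗ.[𝕜] lp (fun _ : X × X => 𝕜) 2 :=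
  ((G.grad 𝕜 μ).domRestrict (finSupp 𝕜 μ)).closure

variable {𝕜 G μ}

theorem finSupp_le_domain_grad : finSupp 𝕜 μ ≤ (G.grad 𝕜 μ).domain :=
  fun _ hf => finiteEnergy_of_finite_support hf

theorem mem_graph_gradMin_of_finite {f : Ell2 𝕜 μ} (hf : f ∈ finSupp 𝕜 μ)
    {k : lp (fun _ : X × X => 𝕜) 2} (hk : (f, k) ∈ (G.grad 𝕜 μ).graph) :
    (f, k) ∈ (G.gradMin 𝕜 μ).graph := by
  refine LinearPMap.le_graph_of_le (LinearPMap.le_closure _) ?_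
  obtain ⟨f', rfl, rfl⟩ := (LinearPMap.mem_graph_iff _).mp hk
  exact (LinearPMap.mem_graph_iff _).mpr
    ⟨⟨f', hf, f'.2⟩, rfl, LinearPMap.domRestrict_apply rfl⟩

theorem finSupp_le_domain_gradMin : finSupp 𝕜 μ ≤ (G.gradMin 𝕜 μ).domain :=
  fun _ hf => LinearPMap.mem_domain_of_mem_graph
    (mem_graph_gradMin_of_finite hf ((G.grad 𝕜 μ).mem_graph ⟨_, finSupp_le_domain_grad hf⟩))

variable (𝕜 G μ) in
theorem isClosable_grad_restrict [Countable X] : ((G.grad 𝕜 μ).domRestrict (finSupp 𝕜 μ)).IsClosable :=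
  (isClosed_grad (𝕜 := 𝕜) (G := G) (μ := μ)).isClosable.leIsClosable LinearPMap.domRestrict_le

variable [Countable X]

theorem isClosed_gradMin : (G.gradMin 𝕜 μ).IsClosed :=
  (isClosable_grad_restrict 𝕜 G μ).closure_isClosed

theorem gradMin_le_grad : G.gradMin 𝕜 μ ≤ G.grad 𝕜 μ := by
  refine LinearPMap.le_of_le_graph ?_
  rw [gradMin, ← (isClosable_grad_restrict 𝕜 G μ).graph_closure_eq_closure_graph]
  exact Submodule.topologicalClosure_minimal _
    (LinearPMap.le_graph_of_le LinearPMap.domRestrict_le) isClosed_grad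

theorem exists_seq_of_mem_graph_gradMin {f : Ell2 𝕜 μ} {k : lp (fun _ : X × X => 𝕜) 2}
    (h : (f, k) ∈ (G.gradMin 𝕜 μ).graph) :
    ∃ (u : ℕ → Ell2 𝕜 μ) (l : ℕ → lp (fun _ : X × X => 𝕜) 2),
      (∀ n, u n ∈ finSupp 𝕜 μ) ∧ (∀ n, (u n, l n) ∈ (G.grad 𝕜 μ).graph) ∧
      Tendsto u atTop (𝓝 f) ∧ Tendsto l atTop (𝓝 k) := by
  rw [gradMin, ← (isClosable_grad_restrict 𝕜 G μ).graph_closure_eq_closure_graph] at h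
  obtain ⟨p, hp, hpf⟩ := mem_closure_iff_seq_limit.mp h
  refine ⟨fun n => (p n).1, fun n => (p n).2, fun n => ?_, fun n => ?_,
    (continuous_fst.tendsto _).comp hpf, (continuous_snd.tendsto _).comp hpf⟩
  · exact (LinearPMap.mem_domain_of_mem_graph (hp n) : _ ∈ finSupp 𝕜 μ ⊓ _).1
  · exact LinearPMap.le_graph_of_le LinearPMap.domRestrict_le (hp n)

/-- Pointwise limits of sequences that are bounded in the form norm stay in the domain of the
minimal gradient. -/
theorem mem_domain_gradMin_of_tendsto {u : ℕ → Ell2 𝕜 μ} (hu : ∀ n, u n ∈ (G.gradMin 𝕜 μ).domain)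
    {f : Ell2 𝕜 μ} (hf : f ∈ (G.grad 𝕜 μ).domain) {C : ℝ} (h1 : ∀ n, ‖u n‖ ^ 2 ≤ C)
    (h2 : ∀ n, G.energy (u n : X → 𝕜) ≤ ENNReal.ofReal C)
    (hl : ∀ x, Tendsto (fun n => (u n : X → 𝕜) x) atTop (𝓝 ((f : X → 𝕜) x))) :
    f ∈ (G.gradMin 𝕜 μ).domain := by
  classical
  -- The graph, as a closed subspace of the Hilbert sum. The indicators in each factor form a total
  -- set, and testing on them is pointwise convergence of functions and of gradients.
  let V : Submodule 𝕜 (WithLp 2 (Ell2 𝕜 μ × lp (fun _ : X × X => 𝕜) 2)) :=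
    (G.gradMin 𝕜 μ).graph.comap (WithLp.linearEquiv 2 𝕜 _).toLinearMap
  have hV : IsClosed (V : Set (WithLp 2 (Ell2 𝕜 μ × lp (fun _ : X × X => 𝕜) 2))) :=
    isClosed_gradMin.preimage (WithLp.prod_continuous_ofLp 2 _ _)
  have hmem : ∀ n, (u n, G.gradMin 𝕜 μ ⟨u n, hu n⟩) ∈ (G.gradMin 𝕜 μ).graph :=
    fun n => (G.gradMin 𝕜 μ).mem_graph ⟨u n, hu n⟩
  have hmem' := fun n => LinearPMap.le_graph_of_le gradMin_le_grad (hmem n)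
  have hC : 0 ≤ C := (sq_nonneg _).trans (h1 0)
  have key := mem_of_tendsto_inner_of_norm_le (𝕜 := 𝕜) hV
    (u := fun n => WithLp.toLp 2 (u n, G.gradMin 𝕜 μ ⟨u n, hu n⟩)) hmem
    (w := WithLp.toLp 2 (f, G.grad 𝕜 μ ⟨f, hf⟩)) (C := √(C + C)) ?_
    (S := Set.range (fun x => WithLp.toLp 2 (Weight.delta 𝕜 μ x, 0)) ∪
      Set.range (fun p => WithLp.toLp 2 (0, lp.single 2 p (1 : 𝕜)))) ?_ ?_
  · exact LinearPMap.mem_domain_of_mem_graph key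
  · intro n
    refine Real.le_sqrt_of_sq_le ?_
    rw [WithLp.prod_norm_sq_eq_of_L2]
    refine add_le_add (h1 n) ?_
    have := h2 n
    rwa [← ofReal_norm_sq_eq_energy (hmem' n), ENNReal.ofReal_le_ofReal_iff hC] at this
  · intro z hz
    have z1 : z.fst = 0 := Weight.eq_zero_of_inner_delta fun x => by
      have := hz _ (Or.inl ⟨x, rfl⟩)
      simpa [WithLp.prod_inner_apply] using this
    have z2 : z.snd = 0 := by
      refine lp.ext (funext fun p => ?_)
      have := hz _ (Or.inr ⟨p, rfl⟩)
      simpa [WithLp.prod_inner_apply, lp.inner_single_left] using this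
    exact WithLp.ofLp_injective 2 (Prod.ext z1 z2)
  · rintro _ (⟨x, rfl⟩ | ⟨p, rfl⟩)
    · simp only [WithLp.prod_inner_apply, inner_zero_left, add_zero, Weight.inner_delta]
      exact (hl x).const_mul _
    · simp only [WithLp.prod_inner_apply, inner_zero_left, zero_add, lp.inner_single_left,
        mem_graph_grad.mp (hmem' _), grad_apply]
      exact (tendsto_const_nhds).inner (tendsto_gradFun hl p)

end MinimalGradient

end WeightedGraph

/-! ## The radial contraction -/

section Clip

variable {𝕜 : Type*} [RCLike 𝕜]

/-- The radial contraction of `𝕜` onto the closed ball of radius `R`. -/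
noncomputable def radialClip (R : ℝ) (z : 𝕜) : 𝕜 := ((min ‖z‖ R / ‖z‖ : ℝ) : 𝕜) * z

theorem radialClip_zero (R : ℝ) : radialClip R (0 : 𝕜) = 0 := mul_zero _

theorem radialClip_of_le {R : ℝ} {z : 𝕜} (h : ‖z‖ ≤ R) : radialClip R z = z := by
  by_cases hz : z = 0
  · rw [hz, radialClip_zero]
  · rw [radialClip, min_eq_left h, div_self (norm_ne_zero_iff.mpr hz), RCLike.ofReal_one, one_mul]

theorem norm_radialClip_le {R : ℝ} (hR : 0 ≤ R) (z : 𝕜) : ‖radialClip R z‖ ≤ R := by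
  by_cases hz : z = 0
  · rwa [hz, radialClip_zero, norm_zero]
  · rw [radialClip, norm_mul, RCLike.norm_ofReal,
      abs_of_nonneg (div_nonneg (le_min (norm_nonneg _) hR) (norm_nonneg _)),
      div_mul_cancel₀ _ (norm_ne_zero_iff.mpr hz)]
    exact min_le_right _ _

theorem norm_real_mul_sub_sq (s t : ℝ) (a b : 𝕜) :
    ‖(s : 𝕜) * a - t * b‖ ^ 2 =
      (s * ‖a‖) ^ 2 - 2 * (s * t) * RCLike.re (inner 𝕜 a b) + (t * ‖b‖) ^ 2 := by
  rw [norm_sub_sq (𝕜 := 𝕜), norm_mul, norm_mul, RCLike.norm_ofReal, RCLike.norm_ofReal, mul_pow,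
    mul_pow, sq_abs, sq_abs]
  have h : inner 𝕜 ((s : 𝕜) * a) (t * b) = ((s * t : ℝ) : 𝕜) * inner 𝕜 a b := by
    rw [← smul_eq_mul, ← smul_eq_mul, inner_smul_left, inner_smul_right, RCLike.conj_ofReal]
    push_cast
    ring
  rw [h, RCLike.re_ofReal_mul]
  ring

theorem lipschitzWith_radialClip {R : ℝ} (hR : 0 ≤ R) :
    LipschitzWith 1 (radialClip R : 𝕜 → 𝕜) := by
  refine LipschitzWith.of_dist_le_mul fun a b => ?_
  rw [NNReal.coe_one, one_mul, dist_eq_norm, dist_eq_norm]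
  refine le_of_sq_le_sq ?_ (norm_nonneg _)
  have hs : ∀ z : 𝕜, min ‖z‖ R / ‖z‖ * ‖z‖ = min ‖z‖ R := fun z => by
    by_cases hz : z = 0
    · simp [hz, hR]
    · exact div_mul_cancel₀ _ (norm_ne_zero_iff.mpr hz)
  have h0 : ∀ z : 𝕜, 0 ≤ min ‖z‖ R / ‖z‖ := fun z =>
    div_nonneg (le_min (norm_nonneg _) hR) (norm_nonneg _)
  have h1 : ∀ z : 𝕜, min ‖z‖ R / ‖z‖ ≤ 1 := fun z =>
    div_le_one_of_le₀ (min_le_left _ _) (norm_nonneg _)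
  have e := norm_real_mul_sub_sq (min ‖a‖ R / ‖a‖) (min ‖b‖ R / ‖b‖) a b
  have e' := norm_real_mul_sub_sq 1 1 a b
  rw [RCLike.ofReal_one, one_mul, one_mul] at e'
  rw [radialClip, radialClip, e, e', hs, hs]
  have hc : RCLike.re (inner 𝕜 a b) ≤ ‖a‖ * ‖b‖ := re_inner_le_norm a b
  have hst : (min ‖a‖ R / ‖a‖) * (min ‖b‖ R / ‖b‖) ≤ 1 := mul_le_one₀ (h1 a) (h0 b) (h1 b)
  have hm : (min ‖a‖ R / ‖a‖) * (min ‖b‖ R / ‖b‖) * (‖a‖ * ‖b‖) = min ‖a‖ R * min ‖b‖ R := by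
    rw [mul_mul_mul_comm, hs, hs]
  have hmin : (min ‖a‖ R - min ‖b‖ R) ^ 2 ≤ (‖a‖ - ‖b‖) ^ 2 :=
    by
    refine sq_le_sq.mpr ((abs_min_sub_min_le_max _ _ _ _).trans ?_)
    rw [sub_self, abs_zero]
    exact max_le le_rfl (abs_nonneg _)
  -- With scaling factors `s, t` in `[0, 1]`, `|s a - t b|² = (s|a| - t|b|)² + 2 s t (|a||b| - Re
  -- ⟪a, b⟫)`, and each summand is at most its value at `s = t = 1`.
  nlinarith [mul_le_mul_of_nonneg_left hc (sub_nonneg.mpr hst)]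

end Clip

/-! ## Realizations from gradients -/

namespace WeightedGraph

variable {𝕜 : Type*} [RCLike 𝕜] {X : Type*} {G : WeightedGraph X} {μ : Weight X}

theorem norm_le_of_graph_grad {f g : Ell2 𝕜 μ} {k l : lp (fun _ : X × X => 𝕜) 2}
    (hk : (f, k) ∈ (G.grad 𝕜 μ).graph) (hl : (g, l) ∈ (G.grad 𝕜 μ).graph)
    (h : G.energy (f : X → 𝕜) ≤ G.energy (g : X → 𝕜)) : ‖k‖ ^ 2 ≤ ‖l‖ ^ 2 := by
  rwa [← ofReal_norm_sq_eq_energy hk, ← ofReal_norm_sq_eq_energy hl,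
    ENNReal.ofReal_le_ofReal_iff (sq_nonneg _)] at h

theorem energy_comp_le {C : 𝕜 → 𝕜} (hC : LipschitzWith 1 C) (f : X → 𝕜) :
    G.energy (C ∘ f) ≤ G.energy f := by
  rw [energy_eq_tsum, energy_eq_tsum]
  exact ENNReal.tsum_le_tsum fun p => ENNReal.ofReal_le_ofReal
    (pow_le_pow_left₀ (norm_nonneg _) (G.norm_gradFun_comp_le hC f p) 2)

/-- The resolvent of a Markovian operator preserves bounds. -/
theorem norm_apply_le_of_isDirichletForm {M : Ell2 𝕜 μ →ₗ.[𝕜] Ell2 𝕜 μ}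
    {q : ClosedForm 𝕜 (Ell2 𝕜 μ)} (hq : q.IsFormOf M) (hD : IsDirichletForm q) {R : ℝ}
    (hR : 0 ≤ R) {p : Ell2 𝕜 μ × Ell2 𝕜 μ} (hp : p ∈ M.graph)
    (hb : ∀ x, ‖((p.2 + p.1 : Ell2 𝕜 μ) : X → 𝕜) x‖ ≤ R) (x : X) :
    ‖(p.1 : X → 𝕜) x‖ ≤ R := by
  obtain ⟨f, m⟩ := p
  obtain ⟨hf, hfm⟩ := (hq f m).mp hp
  have hC := lipschitzWith_radialClip (𝕜 := 𝕜) hR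
  have hC0 := radialClip_zero (𝕜 := 𝕜) R
  obtain ⟨hh, hle⟩ := hD.2 _ hC hC0 ⟨f, hf⟩
  set h : Ell2 𝕜 μ := hC.compLp hC0 f with hdef
  -- Here `m + f = (M + 1) f` is fixed by the clip, so clipping `f` to `h` does not move it away
  -- from `m + f`.
  have hg : hC.compLp hC0 (m + f) = m + f := Weight.ell2_ext fun y => by
    rw [Weight.coe_compLp]
    exact radialClip_of_le (hb y)
  have h1 : ‖h - (m + f)‖ ≤ ‖f - (m + f)‖ := by
    have := hC.norm_compLp_sub_le hC0 f (m + f)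
    rwa [hg, NNReal.coe_one, one_mul] at this
  set d : q.domain := ⟨h, hh⟩ - ⟨f, hf⟩ with hd
  have h2 : (⟨h, hh⟩ : q.domain) = ⟨f, hf⟩ + d := (add_sub_cancel _ _).symm
  -- Expand `q(h) = q(f) + 2 Re ⟪m, h - f⟫ + q(h - f)` and use `q(h) ≤ q(f)` and `0 ≤ q(h - f)`.
  have h3 : RCLike.re (inner 𝕜 m (h - f)) ≤ 0 := by
    have e1 : q.quad ⟨h, hh⟩ = q.quad ⟨f, hf⟩ + 2 * RCLike.re (inner 𝕜 m (h - f)) + q.quad d := by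
      have e2 : q.form ⟨f, hf⟩ d = inner 𝕜 m (h - f) := hfm d
      have e3 : RCLike.re (q.form d ⟨f, hf⟩) = RCLike.re (inner 𝕜 m (h - f)) := by
        rw [← q.hermitian, RCLike.conj_re, e2]
      rw [ClosedForm.quad, ClosedForm.quad, ClosedForm.quad, h2]
      simp only [map_add, LinearMap.add_apply]
      rw [e2, e3]
      ring
    have := hD.1 d
    linarith
  -- The distance estimate reads `‖(h - f) - m‖ ≤ ‖m‖`, hence `‖h - f‖² ≤ 2 Re ⟪m, h - f⟫ ≤ 0`.
  have h4 : h = f := by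
    have e1 : f - (m + f) = -m := by abel
    have e2 : h - (m + f) = (h - f) - m := by abel
    rw [e1, e2, norm_neg] at h1
    have e3 := norm_sub_sq (𝕜 := 𝕜) (h - f) m
    rw [← inner_conj_symm, RCLike.conj_re] at e3
    have e4 : ‖h - f‖ = 0 := by
      have := pow_le_pow_left₀ (norm_nonneg _) h1 2
      nlinarith [norm_nonneg (h - f)]
    exact sub_eq_zero.mp (norm_eq_zero.mp e4)
  have h5 : (f : X → 𝕜) x = radialClip R ((f : X → 𝕜) x) := by
    conv_lhs => rw [← h4, hdef, Weight.coe_compLp]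
    rfl
  change ‖(f : X → 𝕜) x‖ ≤ R
  rw [h5]
  exact norm_radialClip_le hR _

variable [Countable X]

/-! ### The minimal and the maximal Markovian realization -/

section Existence

variable {T : Ell2 𝕜 μ →ₗ.[𝕜] lp (fun _ : X × X => 𝕜) 2}

/-- Pairing `T* T f` with the indicator of `z` gives `⟪T δ_z, T f⟫`, which Green's formula evaluates
to the unweighted Laplacian of `f` at `z`. -/
theorem isRealization_square (hc : T.IsClosed) (hle : T ≤ G.grad 𝕜 μ)
    (hT : finSupp 𝕜 μ ≤ T.domain) : G.IsRealization μ T.square := by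
  have hd : Dense (T.domain : Set (Ell2 𝕜 μ)) := Weight.dense_finSupp.mono hT
  have hg := LinearPMap.le_graph_of_le hle
  refine ⟨LinearPMap.square_isSelfAdjoint hc hd, ⟨0, fun f => ?_⟩,
    ⟨_, LinearPMap.squareForm_isFormOf hc hd, hT⟩, fun f => ?_⟩
  · rw [zero_mul]
    exact LinearPMap.square_isNonneg hd (T.square.mem_graph f)
  · have hf := T.square.mem_graph f
    rw [LinearPMap.graph_square hd] at hf
    obtain ⟨k, hk, h⟩ := hf
    have hE : ((f : Ell2 𝕜 μ) : X → 𝕜) ∈ G.FiniteEnergy :=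
      LinearPMap.mem_domain_of_mem_graph (hg hk)
    refine ⟨finiteEnergy_subset_formalDomain hE, funext fun z => ?_⟩
    have hz := T.mem_graph ⟨Weight.delta 𝕜 μ z, hT (Weight.delta_mem_finSupp z)⟩
    have h1 := h _ hz
    have h2 := inner_grad_delta (hg hz) (hg hk)
    rw [← inner_conj_symm, h2, ← inner_conj_symm (T.square f), Weight.inner_delta] at h1
    rw [formalOp_eq, star_injective h1,
      inv_mul_cancel_left₀ (RCLike.ofReal_ne_zero.mpr (μ.pos z).ne')]

theorem isMarkovianRealization_square (hc : T.IsClosed) (hle : T ≤ G.grad 𝕜 μ)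
    (hT : finSupp 𝕜 μ ≤ T.domain)
    (hC : ∀ (C : 𝕜 → 𝕜) (hC : LipschitzWith 1 C) (hC0 : C 0 = 0), ∀ f ∈ T.domain,
      hC.compLp hC0 f ∈ T.domain) : G.IsMarkovianRealization μ T.square := by
  have hd : Dense (T.domain : Set (Ell2 𝕜 μ)) := Weight.dense_finSupp.mono hT
  have hg := LinearPMap.le_graph_of_le hle
  have hq : ∀ f : T.domain, (T.squareForm hc hd).quad f = ‖T f‖ ^ 2 := fun f =>
    inner_self_eq_norm_sq (𝕜 := 𝕜) (T f)
  refine ⟨isRealization_square hc hle hT, _, LinearPMap.squareForm_isFormOf hc hd,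
    fun f => (sq_nonneg _).trans_eq (hq f).symm, fun C h h0 f => ⟨hC C h h0 f f.2, ?_⟩⟩
  refine (hq _).trans_le (le_trans ?_ (hq f).symm.le)
  refine norm_le_of_graph_grad (hg (T.mem_graph _)) (hg (T.mem_graph f)) ?_
  rw [Weight.coe_compLp]
  exact energy_comp_le h _

variable (𝕜 G μ)

theorem isMarkovianRealization_square_grad :
    G.IsMarkovianRealization μ (G.grad 𝕜 μ).square := by
  refine isMarkovianRealization_square isClosed_grad le_rfl finSupp_le_domain_grad ?_
  intro C hC hC0 f hf
  rw [mem_domain_grad, Weight.coe_compLp]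
  exact (energy_comp_le hC _).trans_lt hf

variable {𝕜 G μ} in
-- Contracting finitely supported approximants keeps them finitely supported and bounded in form
-- norm. They converge pointwise, which suffices without form convergence.
theorem compLp_mem_domain_gradMin {C : 𝕜 → 𝕜} (hC : LipschitzWith 1 C) (hC0 : C 0 = 0)
    {f : Ell2 𝕜 μ} (hf : f ∈ (G.gradMin 𝕜 μ).domain) :
    hC.compLp hC0 f ∈ (G.gradMin 𝕜 μ).domain := by
  obtain ⟨u, l, hu, hl, huf, hlk⟩ :=
    exists_seq_of_mem_graph_gradMin ((G.gradMin 𝕜 μ).mem_graph ⟨f, hf⟩)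
  obtain ⟨C1, hC1⟩ := huf.norm.bddAbove_range
  obtain ⟨C2, hC2⟩ := hlk.norm.bddAbove_range
  have hC1' : ∀ n, ‖u n‖ ≤ C1 := fun n => hC1 ⟨n, rfl⟩
  have hC2' : ∀ n, ‖l n‖ ≤ C2 := fun n => hC2 ⟨n, rfl⟩
  refine mem_domain_gradMin_of_tendsto (u := fun n => hC.compLp hC0 (u n))
    (C := max (C1 ^ 2) (C2 ^ 2)) (fun n => finSupp_le_domain_gradMin ?_) ?_ (fun n => ?_)
    (fun n => ?_) fun x => ?_
  · rw [Weight.mem_finSupp, Weight.coe_compLp]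
    exact (Weight.mem_finSupp.mp (hu n)).subset (Function.support_comp_subset hC0 _)
  · rw [mem_domain_grad, Weight.coe_compLp]
    exact (energy_comp_le hC _).trans_lt (gradMin_le_grad.1 hf)
  · refine le_max_of_le_left (pow_le_pow_left₀ (norm_nonneg _) ?_ 2)
    have := hC.norm_compLp_le hC0 (u n)
    rw [NNReal.coe_one, one_mul] at this
    exact this.trans (hC1' n)
  · rw [Weight.coe_compLp]
    refine (energy_comp_le hC _).trans ?_
    rw [← ofReal_norm_sq_eq_energy (hl n)]
    exact ENNReal.ofReal_le_ofReal
      (le_max_of_le_right (pow_le_pow_left₀ (norm_nonneg _) (hC2' n) 2))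
  · simp only [Weight.coe_compLp]
    exact (hC.continuous.tendsto _).comp (Weight.tendsto_apply huf x)

theorem isMarkovianRealization_square_gradMin :
    G.IsMarkovianRealization μ (G.gradMin 𝕜 μ).square :=
  isMarkovianRealization_square isClosed_gradMin gradMin_le_grad finSupp_le_domain_gradMin
    fun _ hC hC0 _ hf => compLp_mem_domain_gradMin hC hC0 hf

end Existence

/-! ### Identifying an arbitrary Markovian realization -/

section Uniqueness

/-- An operator that acts as the formal operator is the operator of the maximal form on the
functions of finite energy, if finitely supported functions are dense. -/
theorem mem_graph_square_grad (h0 : (G.grad 𝕜 μ).domain ≤ (G.gradMin 𝕜 μ).domain)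
    {f g : Ell2 𝕜 μ} (hf : (f : X → 𝕜) ∈ G.FiniteEnergy)
    (hg : (g : X → 𝕜) = G.formalOp μ (f : X → 𝕜)) : (f, g) ∈ (G.grad 𝕜 μ).square.graph := by
  rw [LinearPMap.graph_square (Weight.dense_finSupp.mono finSupp_le_domain_grad)]
  have hk := (G.grad 𝕜 μ).mem_graph ⟨f, hf⟩
  refine ⟨_, hk, ?_⟩
  set k := G.grad 𝕜 μ ⟨f, hf⟩
  -- Green's formula against finitely supported functions, by linearity from indicators. It extends
  -- to the whole form domain by approximation in form norm, available through `h0`.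
  have h1 : ∀ u ∈ finSupp 𝕜 μ, ∃ l, (u, l) ∈ (G.grad 𝕜 μ).graph ∧ inner 𝕜 k l = inner 𝕜 g u := by
    intro u hu
    rw [Weight.finSupp_eq_span] at hu
    induction hu using Submodule.span_induction with
    | mem u hu =>
      obtain ⟨z, rfl⟩ := hu
      have hz := (G.grad 𝕜 μ).mem_graph ⟨_, finSupp_le_domain_grad (Weight.delta_mem_finSupp z)⟩
      refine ⟨_, hz, ?_⟩
      rw [← inner_conj_symm, inner_grad_delta hz hk, ← inner_conj_symm g, Weight.inner_delta, hg,
        coe_mul_formalOp]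
    | zero => exact ⟨0, Submodule.zero_mem _, by simp⟩
    | add u v _ _ hu hv =>
      obtain ⟨l, hl, e⟩ := hu
      obtain ⟨l', hl', e'⟩ := hv
      exact ⟨l + l', Submodule.add_mem _ hl hl', by rw [inner_add_right, inner_add_right, e, e']⟩
    | smul c u _ hu =>
      obtain ⟨l, hl, e⟩ := hu
      exact ⟨c • l, Submodule.smul_mem _ c hl, by rw [inner_smul_right, inner_smul_right, e]⟩
  rintro ⟨v, r⟩ hr
  have hv := (G.gradMin 𝕜 μ).mem_graph ⟨v, h0 (LinearPMap.mem_domain_of_mem_graph hr)⟩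
  obtain ⟨u, l, hu, hl, huv, hlr⟩ := exists_seq_of_mem_graph_gradMin hv
  rw [← LinearPMap.mem_graph_snd_inj _ hr (LinearPMap.le_graph_of_le gradMin_le_grad hv) rfl]
    at hlr
  have h2 : ∀ n, inner 𝕜 k (l n) = inner 𝕜 g (u n) := fun n => by
    obtain ⟨l', hl', e⟩ := h1 _ (hu n)
    rwa [LinearPMap.mem_graph_snd_inj _ (hl n) hl' rfl]
  have h3 : Tendsto (fun n => inner 𝕜 k (l n)) atTop (𝓝 (inner 𝕜 k r)) :=
    tendsto_const_nhds.inner hlr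
  have h4 : Tendsto (fun n => inner 𝕜 g (u n)) atTop (𝓝 (inner 𝕜 g v)) :=
    tendsto_const_nhds.inner huv
  exact tendsto_nhds_unique (h3.congr h2) h4

/-- Since `(A + 1)⁻¹` is bounded and `B` is closed, agreement on the preimage of a dense set under
`A + 1` gives `A ≤ B`. -/
theorem _root_.LinearPMap.eq_of_dense_range {H : Type*} [NormedAddCommGroup H]
    [InnerProductSpace 𝕜 H] [CompleteSpace H] {A B : H →ₗ.[𝕜] H} (hA : IsSelfAdjoint A)
    (hB : IsSelfAdjoint B) (hn : A.IsNonneg) {D : Set H} (hD : Dense D)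
    (h : ∀ p ∈ A.graph, p.2 + p.1 ∈ D → p ∈ B.graph) : A = B := by
  refine hA.eq_of_le hB (LinearPMap.le_of_le_graph fun p hp => ?_)
  obtain ⟨v, hv, hvp⟩ := mem_closure_iff_seq_limit.mp (hD (p.2 + p.1))
  choose r hr hrv using fun n => hA.surjective_add_one hn (v n)
  have h1 : Tendsto (fun n => (r n).1) atTop (𝓝 p.1) := by
    rw [tendsto_iff_norm_sub_tendsto_zero] at hvp ⊢
    refine squeeze_zero (fun _ => norm_nonneg _) (fun n => ?_) hvp
    refine (hn.norm_le (A.graph.sub_mem (hr n) hp)).trans (le_of_eq ?_)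
    rw [← hrv, Prod.fst_sub, Prod.snd_sub]
    congr 1
    abel
  have h2 : Tendsto (fun n => (r n).2) atTop (𝓝 p.2) := by
    have := hvp.sub h1
    rw [add_sub_cancel_right] at this
    refine this.congr fun n => ?_
    rw [← hrv, add_sub_cancel_right]
  refine hB.isClosed.mem_of_tendsto (h1.prodMk_nhds h2) (Eventually.of_forall fun n => ?_)
  exact h _ (hr n) (by rw [hrv]; exact hv n)

/-- If `(M + 1) f` is finitely supported, it is bounded, so `f` is bounded by the Markov property
and has finite energy by `h1`; then `h0` places it in the domain of `T* T`. Finitely supported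
functions are dense, so this determines `M`. -/
theorem IsMarkovianRealization.eq_square_grad {M : Ell2 𝕜 μ →ₗ.[𝕜] Ell2 𝕜 μ}
    (hM : G.IsMarkovianRealization μ M)
    (h0 : (G.grad 𝕜 μ).domain ≤ (G.gradMin 𝕜 μ).domain)
    (h1 : ∀ (f g : Ell2 𝕜 μ) (R : ℝ), (f : X → 𝕜) ∈ G.formalDomain →
      (g : X → 𝕜) = G.formalOp μ (f : X → 𝕜) → (∀ x, ‖(f : X → 𝕜) x‖ ≤ R) →
      (f : X → 𝕜) ∈ G.FiniteEnergy) : M = (G.grad 𝕜 μ).square := by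
  obtain ⟨hR, q, hq, hD⟩ := hM
  have hn : M.IsNonneg := by
    rintro ⟨f, g⟩ hp
    obtain ⟨hf, h⟩ := (hq f g).mp hp
    have h2 := hD.1 ⟨f, hf⟩
    rwa [ClosedForm.quad, h, ← inner_conj_symm, RCLike.conj_re] at h2
  refine LinearPMap.eq_of_dense_range hR.selfAdjoint
    (isMarkovianRealization_square_grad 𝕜 G μ).1.selfAdjoint hn Weight.dense_finSupp ?_
  rintro p hp hfin
  obtain ⟨R, hR0, hRb⟩ : ∃ R : ℝ, 0 ≤ R ∧ ∀ x, ‖((p.2 + p.1 : Ell2 𝕜 μ) : X → 𝕜) x‖ ≤ R := by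
    have hs := Weight.mem_finSupp.mp hfin
    refine ⟨∑ x ∈ hs.toFinset, ‖((p.2 + p.1 : Ell2 𝕜 μ) : X → 𝕜) x‖,
      Finset.sum_nonneg fun _ _ => norm_nonneg _, fun x => ?_⟩
    by_cases hx : x ∈ hs.toFinset
    · exact Finset.single_le_sum
        (f := fun x => ‖((p.2 + p.1 : Ell2 𝕜 μ) : X → 𝕜) x‖) (fun _ _ => norm_nonneg _) hx
    · have hx0 : ((p.2 + p.1 : Ell2 𝕜 μ) : X → 𝕜) x = 0 := by simpa using hx
      rw [hx0, norm_zero]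
      exact Finset.sum_nonneg fun _ _ => norm_nonneg _
  have hb := norm_apply_le_of_isDirichletForm hq hD hR0 hp hRb
  obtain ⟨f, e1, e2⟩ := (LinearPMap.mem_graph_iff _).mp hp
  obtain ⟨hF, hform⟩ := hR.formal f
  rw [e1] at hF hform
  rw [e2] at hform
  exact mem_graph_square_grad h0 (h1 _ _ R hF hform hb) hform

end Uniqueness

end WeightedGraph

/-! ## The Caccioppoli identity -/

open Classical in
theorem hasSum_prod_of_finset {X α : Type*} [AddCommMonoid α] [TopologicalSpace α]
    [ContinuousAdd α] {F : X × X → α} {a : X → α} (s : Finset X)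
    (h : ∀ x ∈ s, HasSum (fun y => F (x, y)) (a x)) (h0 : ∀ x ∉ s, ∀ y, F (x, y) = 0) :
    HasSum F (∑ x ∈ s, a x) := by
  have h1 : ∀ x ∈ s, HasSum (fun p : X × X => if p.1 = x then F p else 0) (a x) := by
    intro x hx
    have hi : Function.Injective fun y : X => (x, y) := fun a b h => (Prod.ext_iff.mp h).2
    rw [← hi.hasSum_iff]
    · simpa [Function.comp_def] using h x hx
    · rintro ⟨x', y⟩ h
      rw [if_neg]
      rintro rfl
      exact h ⟨y, rfl⟩
  convert hasSum_sum h1 using 2 with p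
  obtain ⟨x, y⟩ := p
  rw [Finset.sum_ite_eq]
  split_ifs with hx
  · rfl
  · exact h0 x hx y

namespace WeightedGraph

variable {𝕜 : Type*} [RCLike 𝕜] {X : Type*} {G : WeightedGraph X}

/-- Bounding `(φ x - φ y)²` by `2 (φ x² + φ y²)` leaves finitely many rows and columns, each
summable because `u` lies in the formal domain. -/
theorem summable_edge_re_inner {u : X → 𝕜} (hu : u ∈ G.formalDomain) {φ : X → ℝ}
    (hφ : (Function.support φ).Finite) :
    Summable fun p : X × X =>
      G.b p.1 p.2 * RCLike.re (inner 𝕜 (u p.1) (u p.2)) * (φ p.1 - φ p.2) ^ 2 := by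
  have hk : Summable fun p : X × X => φ p.1 ^ 2 * ‖u p.1‖ * (G.b p.1 p.2 * ‖u p.2‖) := by
    refine (hasSum_prod_of_finset hφ.toFinset
      (fun x _ => ((hu x).mul_left (φ x ^ 2 * ‖u x‖)).hasSum) fun x hx y => ?_).summable
    have hx0 : φ x = 0 := by simpa using hx
    simp [hx0]
  have hk' := (Equiv.prodComm X X).summable_iff.mpr hk
  refine Summable.of_norm_bounded ((hk.add hk').mul_left 2) fun p => ?_
  simp only [Function.comp_apply, Equiv.prodComm_apply, Prod.fst_swap, Prod.snd_swap]
  rw [G.symm p.2 p.1, norm_mul, norm_mul, Real.norm_of_nonneg (G.nonneg _ _),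
    Real.norm_of_nonneg (sq_nonneg (φ p.1 - φ p.2))]
  have h1 : ‖RCLike.re (inner 𝕜 (u p.1) (u p.2))‖ ≤ ‖u p.1‖ * ‖u p.2‖ :=
    (RCLike.norm_re_le_norm _).trans (norm_inner_le_norm _ _)
  have h2 : (φ p.1 - φ p.2) ^ 2 ≤ 2 * (φ p.1 ^ 2 + φ p.2 ^ 2) := by
    nlinarith [sq_nonneg (φ p.1 + φ p.2)]
  calc G.b p.1 p.2 * ‖RCLike.re (inner 𝕜 (u p.1) (u p.2))‖ * (φ p.1 - φ p.2) ^ 2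
      ≤ G.b p.1 p.2 * (‖u p.1‖ * ‖u p.2‖) * (2 * (φ p.1 ^ 2 + φ p.2 ^ 2)) := by
        have := G.nonneg p.1 p.2
        gcongr
    _ = _ := by ring

/-- The Caccioppoli identity. -/
theorem hasSum_energy_mul {u : X → 𝕜} (hu : u ∈ G.formalDomain) {φ : X → ℝ}
    (hφ : (Function.support φ).Finite) :
    HasSum (fun p : X × X => G.b p.1 p.2 * ‖(φ p.1 : 𝕜) * u p.1 - φ p.2 * u p.2‖ ^ 2)
      (2 * ∑ x ∈ hφ.toFinset, φ x ^ 2 * RCLike.re (inner 𝕜 (u x) (G.lap u x)) +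
        ∑' p : X × X,
          G.b p.1 p.2 * RCLike.re (inner 𝕜 (u p.1) (u p.2)) * (φ p.1 - φ p.2) ^ 2) := by
  have hg : HasSum (fun p : X × X =>
      φ p.1 ^ 2 * (G.b p.1 p.2 * RCLike.re (inner 𝕜 (u p.1) (u p.1 - u p.2))))
      (∑ x ∈ hφ.toFinset, φ x ^ 2 * RCLike.re (inner 𝕜 (u x) (G.lap u x))) := by
    refine hasSum_prod_of_finset _ (fun x _ => HasSum.mul_left _ ?_) fun x hx y => ?_
    · have h1 := RCLike.hasSum_re 𝕜 ((hasSum_lap hu x).mapL (innerSL 𝕜 (u x)))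
      simpa [inner_smul_right_eq_smul, RCLike.smul_re] using h1
    · have hx0 : φ x = 0 := by simpa using hx
      simp [hx0]
  have hg' := (Equiv.prodComm X X).hasSum_iff.mpr hg
  have h := (hg.add hg').add (summable_edge_re_inner hu hφ).hasSum
  rw [← two_mul] at h
  -- Termwise, `|φ x u x - φ y u y|²` equals `φ x² Re ⟪u x, u x - u y⟫ + φ y² Re ⟪u y, u y - u x⟫ +
  -- Re ⟪u x, u y⟫ (φ x - φ y)²`.
  convert h using 2 with p
  simp only [Function.comp_apply, Equiv.prodComm_apply, Prod.fst_swap, Prod.snd_swap]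
  rw [norm_real_mul_sub_sq, G.symm p.2 p.1, inner_sub_right, inner_sub_right, map_sub, map_sub,
    inner_self_eq_norm_sq, inner_self_eq_norm_sq, ← inner_conj_symm (u p.2), RCLike.conj_re]
  ring

theorem energy_eq_of_hasSum {f : X → 𝕜} {s : ℝ}
    (h : HasSum (fun p : X × X => G.b p.1 p.2 * ‖f p.1 - f p.2‖ ^ 2) s) :
    G.energy f = ENNReal.ofReal (s / 2) := by
  have h0 : ∀ p : X × X, 0 ≤ G.b p.1 p.2 * ‖f p.1 - f p.2‖ ^ 2 :=
    fun p => mul_nonneg (G.nonneg p.1 p.2) (sq_nonneg _)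
  rw [energy, ← ENNReal.ofReal_tsum_of_nonneg h0 h.summable, h.tsum_eq,
    ENNReal.ofReal_div_of_pos two_pos, ENNReal.ofReal_ofNat, mul_comm, div_eq_mul_inv]

/-! ## Cut-off functions -/

/-- A nonnegative function of finite energy with finite sublevel sets. -/
structure IsExhaustion (G : WeightedGraph X) (F : X → ℝ) : Prop where
  nonneg : ∀ x, 0 ≤ F x
  finite : ∀ R, {x | F x < R}.Finite
  summable : Summable fun p : X × X => G.b p.1 p.2 * (F p.1 - F p.2) ^ 2

theorem exists_isExhaustion {f : X → 𝕜} (hf : f ∈ G.FiniteEnergy) (hi : TendsToInfinity f) :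
    ∃ F, G.IsExhaustion F := by
  refine ⟨fun x => ‖f x‖, fun x => norm_nonneg _, fun R => ?_, ?_⟩
  · obtain ⟨K, hK, h⟩ := hi R
    refine hK.subset fun x hx => ?_
    by_contra hxK
    exact absurd hx (not_lt.mpr (h x hxK))
  · refine Summable.of_nonneg_of_le (fun p => mul_nonneg (G.nonneg _ _) (sq_nonneg _))
      (fun p => ?_) (G.mem_finiteEnergy_iff.mp hf)
    exact mul_le_mul_of_nonneg_left
      (sq_le_sq.mpr ((abs_norm_sub_norm_le _ _).trans (le_abs_self _))) (G.nonneg _ _)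

/-- The cut-off functions of an exhaustion. -/
noncomputable def cutoff (F : X → ℝ) (n : ℕ) (x : X) : ℝ := max 0 (1 - F x / (n + 1))

theorem cutoff_nonneg (F : X → ℝ) (n : ℕ) (x : X) : 0 ≤ cutoff F n x := le_max_left _ _

theorem cutoff_le_one {F : X → ℝ} (hF : ∀ x, 0 ≤ F x) (n : ℕ) (x : X) : cutoff F n x ≤ 1 :=
  max_le zero_le_one (sub_le_self _ (div_nonneg (hF x) (by positivity)))

theorem cutoff_sub_sq_le (F : X → ℝ) (n : ℕ) (x y : X) :
    (cutoff F n x - cutoff F n y) ^ 2 ≤ (F x - F y) ^ 2 / ((n : ℝ) + 1) ^ 2 := by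
  rw [← div_pow]
  refine sq_le_sq.mpr ((abs_max_sub_max_le_max _ _ _ _).trans ?_)
  rw [sub_self, abs_zero, max_eq_right (abs_nonneg _), abs_sub_comm]
  refine le_of_eq (congrArg _ ?_)
  ring

theorem tendsto_cutoff (F : X → ℝ) (x : X) : Tendsto (fun n => cutoff F n x) atTop (𝓝 1) := by
  have h1 : Tendsto (fun n : ℕ => F x / ((n : ℝ) + 1)) atTop (𝓝 0) :=
    Tendsto.div_atTop tendsto_const_nhds
      (tendsto_atTop_add_const_right _ _ tendsto_natCast_atTop_atTop)
  simpa [cutoff] using (tendsto_const_nhds (x := (0 : ℝ))).max (h1.const_sub 1)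

/-! ### Consequences of an exhaustion -/

namespace IsExhaustion

variable {F : X → ℝ} (hF : G.IsExhaustion F)
include hF

theorem finite_support_cutoff (n : ℕ) : (Function.support (cutoff F n)).Finite := by
  refine (hF.finite (n + 1)).subset fun x hx => ?_
  by_contra h
  refine hx (max_eq_left (sub_nonpos.mpr ?_))
  rw [le_div_iff₀ (by positivity), one_mul]
  exact not_lt.mp h

theorem summable_cutoff (n : ℕ) :
    Summable fun p : X × X => G.b p.1 p.2 * (cutoff F n p.1 - cutoff F n p.2) ^ 2 := by
  refine Summable.of_nonneg_of_le (fun p => mul_nonneg (G.nonneg _ _) (sq_nonneg _))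
    (fun p => ?_) (hF.summable.div_const (((n : ℝ) + 1) ^ 2))
  rw [mul_div_assoc]
  exact mul_le_mul_of_nonneg_left (cutoff_sub_sq_le F n _ _) (G.nonneg _ _)

theorem tsum_cutoff_le (n : ℕ) :
    ∑' p : X × X, G.b p.1 p.2 * (cutoff F n p.1 - cutoff F n p.2) ^ 2 ≤
      (∑' p : X × X, G.b p.1 p.2 * (F p.1 - F p.2) ^ 2) / ((n : ℝ) + 1) ^ 2 := by
  rw [← tsum_div_const]
  refine (hF.summable_cutoff n).tsum_le_tsum (fun p => ?_) (hF.summable.div_const _)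
  rw [mul_div_assoc]
  exact mul_le_mul_of_nonneg_left (cutoff_sub_sq_le F n _ _) (G.nonneg _ _)

theorem tsum_cutoff_le' (n : ℕ) :
    ∑' p : X × X, G.b p.1 p.2 * (cutoff F n p.1 - cutoff F n p.2) ^ 2 ≤
      ∑' p : X × X, G.b p.1 p.2 * (F p.1 - F p.2) ^ 2 := by
  refine (hF.tsum_cutoff_le n).trans (div_le_self (tsum_nonneg fun p => ?_) ?_)
  · exact mul_nonneg (G.nonneg _ _) (sq_nonneg _)
  · exact one_le_pow₀ (by linarith [n.cast_nonneg (α := ℝ)])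

theorem finite_support_mul (n : ℕ) (f : X → 𝕜) :
    (Function.support fun x => (cutoff F n x : 𝕜) * f x).Finite :=
  (hF.finite_support_cutoff n).subset fun x hx h => hx (by simp [h])

theorem one_mem_finiteEnergyZero : (fun _ => 1 : X → 𝕜) ∈ G.FiniteEnergyZero := by
  refine ⟨?_, fun n x => (cutoff F n x : 𝕜), fun n => ?_, fun x => ?_, ?_⟩
  · rw [mem_finiteEnergy_iff]
    simp
  · simpa using hF.finite_support_mul (𝕜 := 𝕜) n fun _ => 1
  · have := (RCLike.continuous_ofReal (K := 𝕜)).continuousAt.tendsto.comp (tendsto_cutoff F x)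
    rwa [RCLike.ofReal_one] at this
  · set S := ∑' p : X × X, G.b p.1 p.2 * (F p.1 - F p.2) ^ 2
    have h1 : Tendsto (fun n : ℕ => ENNReal.ofReal (S / ((n : ℝ) + 1) ^ 2 / 2)) atTop (𝓝 0) := by
      have h2 : Tendsto (fun n : ℕ => S / ((n : ℝ) + 1) ^ 2) atTop (𝓝 0) :=
        Tendsto.div_atTop tendsto_const_nhds ((tendsto_pow_atTop two_ne_zero).comp
          (tendsto_atTop_add_const_right _ _ tendsto_natCast_atTop_atTop))
      simpa using ENNReal.tendsto_ofReal (h2.div_const 2)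
    refine tendsto_of_tendsto_of_tendsto_of_le_of_le tendsto_const_nhds h1 (fun _ => zero_le)
      fun n => ?_
    have h3 : ((fun _ => 1 : X → 𝕜) - fun x => (cutoff F n x : 𝕜)) =
        fun x => ((1 - cutoff F n x : ℝ) : 𝕜) := by
      funext x
      simp
    have h4 : HasSum (fun p : X × X => G.b p.1 p.2 *
        ‖((1 - cutoff F n p.1 : ℝ) : 𝕜) - ((1 - cutoff F n p.2 : ℝ) : 𝕜)‖ ^ 2)
        (∑' p : X × X, G.b p.1 p.2 * (cutoff F n p.1 - cutoff F n p.2) ^ 2) := by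
      convert (hF.summable_cutoff n).hasSum using 2 with p
      rw [← RCLike.ofReal_sub, RCLike.norm_ofReal, sq_abs]
      ring
    dsimp only
    rw [h3, energy_eq_of_hasSum (f := fun x => ((1 - cutoff F n x : ℝ) : 𝕜)) h4]
    refine ENNReal.ofReal_le_ofReal (div_le_div_of_nonneg_right (hF.tsum_cutoff_le n) two_pos.le)

variable [Countable X] {μ : Weight X}

/-- Bounded functions in the domain of the formal operator have finite energy. -/
theorem finiteEnergy_of_bounded {f g : Ell2 𝕜 μ} {R : ℝ} (hf : (f : X → 𝕜) ∈ G.formalDomain)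
    (hg : (g : X → 𝕜) = G.formalOp μ (f : X → 𝕜)) (hR : ∀ x, ‖(f : X → 𝕜) x‖ ≤ R) :
    (f : X → 𝕜) ∈ G.FiniteEnergy := by
  set S := ∑' p : X × X, G.b p.1 p.2 * (F p.1 - F p.2) ^ 2
  -- In the Caccioppoli identity for the cut-offs, the Laplacian term is bounded through `2 |f| |g|
  -- ≤ |f|² + |g|²` and the edge term by `R²` times the energy sum of `F`.
  refine (energy_le_of_tendsto (u := fun n x => (cutoff F n x : 𝕜) * (f : X → 𝕜) x)
    (C := ENNReal.ofReal ((‖f‖ ^ 2 + ‖g‖ ^ 2 + R ^ 2 * S) / 2)) (fun x => ?_)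
    fun n => ?_).trans_lt ENNReal.ofReal_lt_top
  · have := ((RCLike.continuous_ofReal (K := 𝕜)).continuousAt.tendsto.comp
      (tendsto_cutoff F x)).mul_const ((f : X → 𝕜) x)
    rwa [RCLike.ofReal_one, one_mul] at this
  · have hs := hF.finite_support_cutoff n
    rw [energy_eq_of_hasSum (f := fun x => (cutoff F n x : 𝕜) * (f : X → 𝕜) x)
      (hasSum_energy_mul hf hs)]
    refine ENNReal.ofReal_le_ofReal (div_le_div_of_nonneg_right (add_le_add ?_ ?_) two_pos.le)
    · have h1 := sum_le_hasSum hs.toFinset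
        (fun x _ => add_nonneg (mul_nonneg (μ.pos x).le (sq_nonneg _))
          (mul_nonneg (μ.pos x).le (sq_nonneg _)))
        ((Weight.hasSum_norm_sq f).add (Weight.hasSum_norm_sq g))
      refine le_trans ?_ h1
      rw [Finset.mul_sum]
      refine Finset.sum_le_sum fun x _ => ?_
      rw [← coe_mul_formalOp G μ, ← hg, ← smul_eq_mul (μ x : 𝕜), inner_smul_right, RCLike.re_ofReal_mul]
      have h2 : RCLike.re (inner 𝕜 ((f : X → 𝕜) x) ((g : X → 𝕜) x)) ≤
        ‖(f : X → 𝕜) x‖ * ‖(g : X → 𝕜) x‖ := re_inner_le_norm _ _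
      have h3 : cutoff F n x ^ 2 ≤ 1 :=
        pow_le_one₀ (cutoff_nonneg F n x) (cutoff_le_one hF.nonneg n x)
      have h4 := (μ.pos x).le
      calc 2 * (cutoff F n x ^ 2 *
            (μ x * RCLike.re (inner 𝕜 ((f : X → 𝕜) x) ((g : X → 𝕜) x))))
          ≤ 2 * (cutoff F n x ^ 2 * (μ x * (‖(f : X → 𝕜) x‖ * ‖(g : X → 𝕜) x‖))) := by gcongr
        _ ≤ 2 * (1 * (μ x * (‖(f : X → 𝕜) x‖ * ‖(g : X → 𝕜) x‖))) := by gcongr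
        _ ≤ _ := by
          nlinarith [mul_nonneg h4 (sq_nonneg (‖(f : X → 𝕜) x‖ - ‖(g : X → 𝕜) x‖))]
    · refine le_trans ?_ (mul_le_mul_of_nonneg_left (hF.tsum_cutoff_le' n) (sq_nonneg R))
      rw [← tsum_mul_left]
      refine (summable_edge_re_inner hf hs).tsum_le_tsum (fun p => ?_)
        ((hF.summable_cutoff n).mul_left _)
      rw [mul_left_comm, mul_assoc]
      refine mul_le_mul_of_nonneg_left (mul_le_mul_of_nonneg_right ?_ (sq_nonneg _))
        (G.nonneg _ _)
      refine (re_inner_le_norm _ _).trans ?_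
      rw [sq]
      exact mul_le_mul (hR _) (hR _) (norm_nonneg _) ((norm_nonneg _).trans (hR p.1))

/-- The products of `f` with the cut-offs are finitely supported, converge pointwise to `f`, and
stay bounded in form norm by the product rule. -/
theorem mem_domain_gradMin_of_bounded {f : Ell2 𝕜 μ} {R : ℝ}
    (hf : (f : X → 𝕜) ∈ G.FiniteEnergy) (hR : ∀ x, ‖(f : X → 𝕜) x‖ ≤ R) :
    f ∈ (G.gradMin 𝕜 μ).domain := by
  set S := ∑' p : X × X, G.b p.1 p.2 * (F p.1 - F p.2) ^ 2
  have hf' := G.mem_finiteEnergy_iff.mp hf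
  set Q := ∑' p : X × X, G.b p.1 p.2 * ‖(f : X → 𝕜) p.1 - (f : X → 𝕜) p.2‖ ^ 2
  have hu : ∀ n, ((μ.memLp_of_finite_support (hF.finite_support_mul n (f : X → 𝕜))).toLp _ :
      X → 𝕜) = fun x => (cutoff F n x : 𝕜) * (f : X → 𝕜) x := fun n => Weight.coe_toLp _
  refine mem_domain_gradMin_of_tendsto
    (u := fun n => (μ.memLp_of_finite_support (hF.finite_support_mul n (f : X → 𝕜))).toLp _)
    (C := max (‖f‖ ^ 2) ((2 * (R ^ 2 * S + Q)) / 2)) (fun n => finSupp_le_domain_gradMin ?_) hf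
    (fun n => le_max_of_le_left ?_) (fun n => ?_) fun x => ?_
  · rw [Weight.mem_finSupp, hu]
    exact hF.finite_support_mul n _
  · refine hasSum_le (fun x => ?_) (Weight.hasSum_norm_sq _) (Weight.hasSum_norm_sq f)
    rw [hu, norm_mul, RCLike.norm_ofReal, abs_of_nonneg (cutoff_nonneg F n x)]
    refine mul_le_mul_of_nonneg_left (pow_le_pow_left₀ ?_ ?_ 2) (μ.pos x).le
    · exact mul_nonneg (cutoff_nonneg F n x) (norm_nonneg _)
    · exact mul_le_of_le_one_left (norm_nonneg _) (cutoff_le_one hF.nonneg n x)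
  · rw [hu]
    -- The Caccioppoli identity serves only for summability here; the bound comes from the product
    -- rule.
    have hs := (hasSum_energy_mul (finiteEnergy_subset_formalDomain hf)
      (hF.finite_support_cutoff n)).summable
    rw [energy_eq_of_hasSum (f := fun x => (cutoff F n x : 𝕜) * (f : X → 𝕜) x) hs.hasSum]
    refine ENNReal.ofReal_le_ofReal (le_max_of_le_right
      (div_le_div_of_nonneg_right ?_ two_pos.le))
    refine (hs.tsum_le_tsum (fun p => ?_)
      ((((hF.summable_cutoff n).mul_left (R ^ 2)).add hf').mul_left 2)).trans ?_
    · have h1 : (cutoff F n p.1 : 𝕜) * (f : X → 𝕜) p.1 - cutoff F n p.2 * (f : X → 𝕜) p.2 =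
          ((cutoff F n p.1 - cutoff F n p.2 : ℝ) : 𝕜) * (f : X → 𝕜) p.1 +
            (cutoff F n p.2 : 𝕜) * ((f : X → 𝕜) p.1 - (f : X → 𝕜) p.2) := by
        push_cast
        ring
      have h2 := norm_add_le (((cutoff F n p.1 - cutoff F n p.2 : ℝ) : 𝕜) * (f : X → 𝕜) p.1)
        ((cutoff F n p.2 : 𝕜) * ((f : X → 𝕜) p.1 - (f : X → 𝕜) p.2))
      rw [← h1, norm_mul, norm_mul, RCLike.norm_ofReal, RCLike.norm_ofReal,
        abs_of_nonneg (cutoff_nonneg F n p.2)] at h2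
      have h3 : cutoff F n p.2 * ‖(f : X → 𝕜) p.1 - (f : X → 𝕜) p.2‖ ≤
          ‖(f : X → 𝕜) p.1 - (f : X → 𝕜) p.2‖ :=
        mul_le_of_le_one_left (norm_nonneg _) (cutoff_le_one hF.nonneg n _)
      have h4 : |cutoff F n p.1 - cutoff F n p.2| * ‖(f : X → 𝕜) p.1‖ ≤
          |cutoff F n p.1 - cutoff F n p.2| * R := by gcongr; exact hR _
      have h5 := (h2.trans (add_le_add h4 h3))
      have h6 := pow_le_pow_left₀ (norm_nonneg _) h5 2
      have h7 := sq_abs (cutoff F n p.1 - cutoff F n p.2)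
      have h8 : G.b p.1 p.2 *
          ‖(cutoff F n p.1 : 𝕜) * (f : X → 𝕜) p.1 - cutoff F n p.2 * (f : X → 𝕜) p.2‖ ^ 2 ≤
          G.b p.1 p.2 * (2 * (R ^ 2 * (cutoff F n p.1 - cutoff F n p.2) ^ 2 +
            ‖(f : X → 𝕜) p.1 - (f : X → 𝕜) p.2‖ ^ 2)) := by
        refine mul_le_mul_of_nonneg_left (h6.trans ?_) (G.nonneg _ _)
        rw [← h7]
        nlinarith [sq_nonneg (|cutoff F n p.1 - cutoff F n p.2| * R -
          ‖(f : X → 𝕜) p.1 - (f : X → 𝕜) p.2‖)]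
      exact h8.trans_eq (by ring)
    · rw [tsum_mul_left, ((hF.summable_cutoff n).mul_left (R ^ 2)).tsum_add hf', tsum_mul_left]
      have := mul_le_mul_of_nonneg_left (hF.tsum_cutoff_le' n) (sq_nonneg R)
      linarith
  · simp only [hu]
    have := ((RCLike.continuous_ofReal (K := 𝕜)).continuousAt.tendsto.comp
      (tendsto_cutoff F x)).mul_const ((f : X → 𝕜) x)
    rwa [RCLike.ofReal_one, one_mul] at this

/-- Reduction to the bounded case: clipping at height `n` increases neither norm nor energy and is
eventually the identity at each vertex. -/
theorem domain_grad_le : (G.grad 𝕜 μ).domain ≤ (G.gradMin 𝕜 μ).domain := by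
  intro f hf
  have hn : ∀ n : ℕ, (0 : ℝ) ≤ n := fun n => n.cast_nonneg
  have hen : ∀ n : ℕ, G.energy ((lipschitzWith_radialClip (𝕜 := 𝕜) (hn n)).compLp
      (radialClip_zero _) f : X → 𝕜) ≤ G.energy (f : X → 𝕜) := fun n => by
    rw [Weight.coe_compLp]
    exact energy_comp_le (lipschitzWith_radialClip (hn n)) _
  refine mem_domain_gradMin_of_tendsto
    (u := fun n : ℕ => (lipschitzWith_radialClip (𝕜 := 𝕜) (hn n)).compLp (radialClip_zero _) f)
    (C := max (‖f‖ ^ 2) (G.energy (f : X → 𝕜)).toReal)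
    (fun n => hF.mem_domain_gradMin_of_bounded (R := n) ((hen n).trans_lt hf) fun x => ?_) hf
    (fun n => le_max_of_le_left (pow_le_pow_left₀ (norm_nonneg _) ?_ 2)) (fun n => ?_)
    fun x => ?_
  · rw [Weight.coe_compLp]
    exact norm_radialClip_le (hn n) _
  · have := (lipschitzWith_radialClip (𝕜 := 𝕜) (hn n)).norm_compLp_le (radialClip_zero _) f
    rwa [NNReal.coe_one, one_mul] at this
  · refine (hen n).trans ?_
    rw [← ENNReal.ofReal_toReal (ne_top_of_lt hf)]
    exact ENNReal.ofReal_le_ofReal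
      ((le_max_right _ _).trans_eq (by rw [ENNReal.toReal_ofReal ENNReal.toReal_nonneg]))
  · simp only [Weight.coe_compLp]
    refine tendsto_const_nhds.congr' ?_
    filter_upwards [eventually_ge_atTop ⌈‖(f : X → 𝕜) x‖⌉₊] with n hn
    exact (radialClip_of_le (Nat.ceil_le.mp hn)).symm

/-- Recurrence implies Markov uniqueness. -/
theorem existsUnique_isMarkovianRealization (μ : Weight X) :
    ∃! M : Ell2 𝕜 μ →ₗ.[𝕜] Ell2 𝕜 μ, G.IsMarkovianRealization μ M :=
  ⟨_, isMarkovianRealization_square_grad 𝕜 G μ, fun _ hM =>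
    hM.eq_square_grad hF.domain_grad_le fun _ _ _ => hF.finiteEnergy_of_bounded⟩

end IsExhaustion

end WeightedGraph

/-! ## The minimal operator -/

namespace WeightedGraph

variable {𝕜 : Type*} [RCLike 𝕜] {X : Type*} {G : WeightedGraph X} {μ : Weight X}

theorem mem_graph_Hmin {h : G.FC μ} {p : Ell2 𝕜 μ × Ell2 𝕜 μ} :
    p ∈ (G.Hmin 𝕜 μ h).graph ↔
      p.1 ∈ finSupp 𝕜 μ ∧ (p.2 : X → 𝕜) = G.formalOp μ (p.1 : X → 𝕜) := by
  rw [LinearPMap.mem_graph_iff]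
  constructor
  · rintro ⟨f, hf, hg⟩
    rw [← hf, ← hg]
    exact ⟨f.2, Weight.coe_toLp (h.memLp_formalOp f.2)⟩
  · rintro ⟨h1, h2⟩
    refine ⟨⟨p.1, h1⟩, rfl, Weight.ell2_ext fun x => ?_⟩
    rw [h2]
    exact congrFun (Weight.coe_toLp (h.memLp_formalOp h1)) x

open Classical in
theorem lap_single (z x : X) :
    G.lap (Pi.single z (1 : 𝕜)) x =
      (Pi.single z (∑' y, (G.b z y : 𝕜)) : X → 𝕜) x - (G.b z x : 𝕜) := by
  have hs : ∀ x, Summable fun y => (G.b x y : 𝕜) := fun x =>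
    ((RCLike.hasSum_ofReal 𝕜).mpr (G.summable x).hasSum).summable
  have h1 : HasSum (fun y => (G.b x y : 𝕜) * (Pi.single z (1 : 𝕜) : X → 𝕜) x)
      ((Pi.single z (∑' y, (G.b z y : 𝕜)) : X → 𝕜) x) := by
    by_cases hx : x = z
    · subst hx
      simpa using (hs x).hasSum
    · simp [hx]
  have h2 : HasSum (fun y => (G.b x y : 𝕜) * (Pi.single z (1 : 𝕜) : X → 𝕜) y) (G.b z x : 𝕜) := by
    convert hasSum_single z fun y hy => ?_ using 1
    · simp [G.symm x z]
    · simp [hy]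
  refine ((h1.sub h2).tsum_eq ▸ tsum_congr fun y => ?_)
  rw [RCLike.real_smul_eq_coe_mul, mul_sub]

theorem graph_Hmin_le {h : G.FC μ} {V : Submodule 𝕜 (Ell2 𝕜 μ × Ell2 𝕜 μ)}
    (hV : ∀ z g, (Weight.delta 𝕜 μ z, g) ∈ (G.Hmin 𝕜 μ h).graph → (Weight.delta 𝕜 μ z, g) ∈ V) :
    (G.Hmin 𝕜 μ h).graph ≤ V := by
  have h1 : ∀ u ∈ finSupp 𝕜 μ, ∃ g, (u, g) ∈ (G.Hmin 𝕜 μ h).graph ∧ (u, g) ∈ V := by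
    intro u hu
    rw [Weight.finSupp_eq_span] at hu
    induction hu using Submodule.span_induction with
    | mem u hu =>
      obtain ⟨z, rfl⟩ := hu
      have hz := (G.Hmin 𝕜 μ h).mem_graph ⟨_, Weight.delta_mem_finSupp z⟩
      exact ⟨_, hz, hV z _ hz⟩
    | zero => exact ⟨0, Submodule.zero_mem _, Submodule.zero_mem _⟩
    | add u v _ _ hu hv =>
      obtain ⟨g, hg, e⟩ := hu
      obtain ⟨g', hg', e'⟩ := hv
      exact ⟨g + g', Submodule.add_mem _ hg hg', Submodule.add_mem _ e e'⟩
    | smul c u _ hu =>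
      obtain ⟨g, hg, e⟩ := hu
      exact ⟨c • g, Submodule.smul_mem _ c hg, Submodule.smul_mem _ c e⟩
  rintro ⟨u, g⟩ hp
  obtain ⟨g', hg', hgV⟩ := h1 u (LinearPMap.mem_domain_of_mem_graph hp)
  rwa [LinearPMap.mem_graph_snd_inj _ hp hg' rfl]

variable [Countable X]

theorem FC.summable (h : G.FC μ) (x : X) : Summable fun y => μ y * (G.b x y / μ y) ^ 2 := by
  have := μ.memLp_iff.mp (h x)
  simpa only [Real.norm_eq_abs, sq_abs] using this

/-- The sum of `b(x, y) |f y|` over `y` is an `ℓ²` pairing of `|f|` with the function in (FC). -/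
theorem FC.mem_formalDomain (h : G.FC μ) (f : Ell2 𝕜 μ) : (f : X → 𝕜) ∈ G.formalDomain := by
  intro x
  refine Summable.of_nonneg_of_le (fun y => mul_nonneg (G.nonneg x y) (norm_nonneg _))
    (fun y => ?_) ((h.summable x).add (Weight.hasSum_norm_sq f).summable)
  have h1 : G.b x y * ‖(f : X → 𝕜) y‖ = μ y * (G.b x y / μ y * ‖(f : X → 𝕜) y‖) := by
    rw [← mul_assoc, mul_div_cancel₀ _ (μ.pos y).ne']
  rw [h1, ← mul_add]
  refine mul_le_mul_of_nonneg_left ?_ (μ.pos y).le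
  nlinarith [sq_nonneg (G.b x y / μ y - ‖(f : X → 𝕜) y‖), sq_nonneg (G.b x y / μ y),
    sq_nonneg ‖(f : X → 𝕜) y‖]

/-- Green's formula for the indicator function of a vertex. -/
theorem inner_Hmin_delta {h : G.FC μ} {z : X} {g f : Ell2 𝕜 μ}
    (hg : (Weight.delta 𝕜 μ z, g) ∈ (G.Hmin 𝕜 μ h).graph)
    (hf : (f : X → 𝕜) ∈ G.formalDomain) : inner 𝕜 g f = G.lap (f : X → 𝕜) z := by
  classical
  obtain ⟨-, hg⟩ := mem_graph_Hmin.mp hg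
  simp only [Weight.coe_delta] at hg
  have hs : Summable fun y => (G.b z y : 𝕜) :=
    ((RCLike.hasSum_ofReal 𝕜).mpr (G.summable z).hasSum).summable
  have hs2 : Summable fun y => (G.b z y : 𝕜) * (f : X → 𝕜) y :=
    Summable.of_norm ((hf z).congr fun y => by
      rw [norm_mul, RCLike.norm_ofReal, abs_of_nonneg (G.nonneg z y)])
  have h1 : HasSum (fun x => (Pi.single z (∑' y, (G.b z y : 𝕜)) : X → 𝕜) x * (f : X → 𝕜) x)
      ((∑' y, (G.b z y : 𝕜)) * (f : X → 𝕜) z) := by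
    convert hasSum_single z fun y hy => ?_ using 1
    · simp
    · simp [hy]
  have h2 := h1.sub hs2.hasSum
  have h3 : HasSum (fun y => G.b z y • ((f : X → 𝕜) z - (f : X → 𝕜) y))
      ((∑' y, (G.b z y : 𝕜)) * (f : X → 𝕜) z - ∑' y, (G.b z y : 𝕜) * (f : X → 𝕜) y) := by
    simp only [RCLike.real_smul_eq_coe_mul, mul_sub]
    exact (hs.hasSum.mul_right ((f : X → 𝕜) z)).sub hs2.hasSum
  rw [(hasSum_lap hf z).unique h3]
  refine (Weight.hasSum_inner g f).unique ?_
  have hc : ∀ x, conj ((Pi.single z (∑' y, (G.b z y : 𝕜)) : X → 𝕜) x) =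
      (Pi.single z (∑' y, (G.b z y : 𝕜)) : X → 𝕜) x := fun x => by
    rw [← RCLike.ofReal_tsum]
    by_cases hx : x = z
    · subst hx
      simp
    · simp [hx]
  have e : ∀ x, (μ x : 𝕜) * inner 𝕜 ((g : X → 𝕜) x) ((f : X → 𝕜) x) =
      (Pi.single z (∑' y, (G.b z y : 𝕜)) : X → 𝕜) x * (f : X → 𝕜) x -
        (G.b z x : 𝕜) * (f : X → 𝕜) x := fun x => by
    rw [RCLike.inner_apply', ← mul_assoc, hg, ← RCLike.conj_ofReal (μ x), ← map_mul,
      coe_mul_formalOp, lap_single, map_sub, hc, RCLike.conj_ofReal, sub_mul]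
  rw [funext e]
  exact h2

/-- Every realization extends the minimal operator. -/
theorem IsRealization.Hmin_le {M : Ell2 𝕜 μ →ₗ.[𝕜] Ell2 𝕜 μ} (hM : G.IsRealization μ M)
    (h : G.FC μ) : G.Hmin 𝕜 μ h ≤ M := by
  refine LinearPMap.le_of_le_graph (graph_Hmin_le fun z g hg => ?_)
  refine hM.selfAdjoint.mem_graph.mpr fun r hr => ?_
  obtain ⟨f, e1, e2⟩ := (LinearPMap.mem_graph_iff _).mp hr
  obtain ⟨hF, hform⟩ := hM.formal f
  rw [e1] at hF hform
  rw [e2] at hform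
  rw [← inner_conj_symm, ← inner_conj_symm r.1]
  refine congrArg _ ?_
  rw [inner_Hmin_delta hg hF, Weight.inner_delta, hform, coe_mul_formalOp]

/-- Realizations are closed and extend `H^min`, hence extend its self-adjoint closure and equal it.
-/
theorem existsUnique_isRealization {h : G.FC μ} (hs : IsEssSelfAdjoint (G.Hmin 𝕜 μ h)) :
    ∃! M : Ell2 𝕜 μ →ₗ.[𝕜] Ell2 𝕜 μ, G.IsRealization μ M := by
  have key : ∀ M : Ell2 𝕜 μ →ₗ.[𝕜] Ell2 𝕜 μ, G.IsRealization μ M →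
      (G.Hmin 𝕜 μ h).closure = M := fun M hM => by
    refine hs.2.eq_of_le hM.selfAdjoint (LinearPMap.le_of_le_graph ?_)
    rw [← hs.1.graph_closure_eq_closure_graph]
    exact Submodule.topologicalClosure_minimal _ (LinearPMap.le_graph_of_le (hM.Hmin_le h))
      hM.selfAdjoint.isClosed
  have h0 := (isMarkovianRealization_square_grad 𝕜 G μ).1
  exact ⟨_, h0, fun M hM => (key M hM).symm.trans (key _ h0)⟩

/-- The minimal operator is essentially self-adjoint if the weight dominates the energy density
of an exhaustion. -/
theorem IsExhaustion.isEssSelfAdjoint {F : X → ℝ} (hF : G.IsExhaustion F) (h : G.FC μ)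
    (hμ : ∀ x, ∑' y, G.b x y * (F x - F y) ^ 2 ≤ μ x) : IsEssSelfAdjoint (G.Hmin 𝕜 μ h) := by
  have hle := (isMarkovianRealization_square_grad 𝕜 G μ).1.Hmin_le h
  have hgr := LinearPMap.le_graph_of_le hle
  have hsa := (isMarkovianRealization_square_grad 𝕜 G μ).1.selfAdjoint
  refine LinearPMap.isEssSelfAdjoint_of_range_dense Weight.dense_finSupp
    (fun p hp r hr => hsa.isSymm (hgr hp) (hgr hr))
    (fun p hp => LinearPMap.square_isNonneg
      (Weight.dense_finSupp.mono finSupp_le_domain_grad) (hgr hp)) fun u hu => ?_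
  have hu0 := h.mem_formalDomain u
  -- Orthogonality to the range of `H^min + 1`, tested on indicators: `𝓗 u = -u`.
  have hlap : ∀ z, G.lap (u : X → 𝕜) z = ((-μ z : ℝ) : 𝕜) * (u : X → 𝕜) z := fun z => by
    have hz := (G.Hmin 𝕜 μ h).mem_graph ⟨_, Weight.delta_mem_finSupp z⟩
    have h1 := hu _ hz
    rw [inner_add_left, inner_Hmin_delta hz hu0, Weight.inner_delta] at h1
    rw [eq_neg_of_add_eq_zero_left h1]
    push_cast
    ring
  have hE : ∀ x, Summable fun y => G.b x y * (F x - F y) ^ 2 := fun x =>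
    hF.summable.prod_factor x
  have hb0 : ∀ x y t, 0 ≤ G.b x y * t ^ 2 := fun x y t =>
    mul_nonneg (G.nonneg x y) (sq_nonneg t)
  -- This is where the weight must dominate the energy density: each row is at most `μ x |u x|²`.
  have hD : Summable fun p : X × X =>
      ‖(u : X → 𝕜) p.1‖ ^ 2 * (G.b p.1 p.2 * (F p.1 - F p.2) ^ 2) := by
    have h0 : ∀ p : X × X, 0 ≤ ‖(u : X → 𝕜) p.1‖ ^ 2 * (G.b p.1 p.2 * (F p.1 - F p.2) ^ 2) :=
      fun p => mul_nonneg (sq_nonneg _) (hb0 _ _ _)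
    refine (summable_prod_of_nonneg h0).mpr
      ⟨fun x => (hE x).mul_left (‖(u : X → 𝕜) x‖ ^ 2), ?_⟩
    · refine Summable.of_nonneg_of_le (fun x => tsum_nonneg fun y => h0 (x, y)) (fun x => ?_)
        (Weight.hasSum_norm_sq u).summable
      · dsimp only
        rw [tsum_mul_left, mul_comm]
        exact mul_le_mul_of_nonneg_right (hμ x) (sq_nonneg _)
  have hD' := (Equiv.prodComm X X).summable_iff.mpr hD
  set S := ∑' p : X × X, ((‖(u : X → 𝕜) p.1‖ ^ 2 * (G.b p.1 p.2 * (F p.1 - F p.2) ^ 2)) +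
    ‖(u : X → 𝕜) p.2‖ ^ 2 * (G.b p.2 p.1 * (F p.2 - F p.1) ^ 2)) with hS
  -- In the Caccioppoli identity the left side is nonnegative and the Laplacian term is `-2 ∑ φ² μ
  -- |u|²`, so the edge term, at most `S / (n+1)²`, controls every single vertex.
  have key : ∀ (n : ℕ) x, 2 * (cutoff F n x ^ 2 * (μ x * ‖(u : X → 𝕜) x‖ ^ 2)) ≤
      S / ((n : ℝ) + 1) ^ 2 := by
    intro n x
    have hs := hF.finite_support_cutoff n
    have h0 : ∀ p : X × X, 0 ≤ G.b p.1 p.2 *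
        ‖(cutoff F n p.1 : 𝕜) * (u : X → 𝕜) p.1 - cutoff F n p.2 * (u : X → 𝕜) p.2‖ ^ 2 :=
      fun p => hb0 _ _ _
    have h1 := (hasSum_energy_mul hu0 hs).nonneg h0
    have h2 : ∑' p : X × X, G.b p.1 p.2 *
        RCLike.re (inner 𝕜 ((u : X → 𝕜) p.1) ((u : X → 𝕜) p.2)) *
          (cutoff F n p.1 - cutoff F n p.2) ^ 2 ≤ S / ((n : ℝ) + 1) ^ 2 := by
      rw [hS, ← tsum_div_const]
      refine (summable_edge_re_inner hu0 hs).tsum_le_tsum (fun p => ?_)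
        ((hD.add hD').div_const _)
      have h3 : RCLike.re (inner 𝕜 ((u : X → 𝕜) p.1) ((u : X → 𝕜) p.2)) ≤
          ‖(u : X → 𝕜) p.1‖ ^ 2 + ‖(u : X → 𝕜) p.2‖ ^ 2 := by
        refine (re_inner_le_norm _ _).trans ?_
        nlinarith [sq_nonneg (‖(u : X → 𝕜) p.1‖ - ‖(u : X → 𝕜) p.2‖),
          sq_nonneg ‖(u : X → 𝕜) p.1‖, sq_nonneg ‖(u : X → 𝕜) p.2‖]
      have h4 := cutoff_sub_sq_le F n p.1 p.2
      have h5 := G.nonneg p.1 p.2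
      calc G.b p.1 p.2 * RCLike.re (inner 𝕜 ((u : X → 𝕜) p.1) ((u : X → 𝕜) p.2)) *
            (cutoff F n p.1 - cutoff F n p.2) ^ 2
          ≤ G.b p.1 p.2 * (‖(u : X → 𝕜) p.1‖ ^ 2 + ‖(u : X → 𝕜) p.2‖ ^ 2) *
            (cutoff F n p.1 - cutoff F n p.2) ^ 2 := by gcongr
        _ ≤ G.b p.1 p.2 * (‖(u : X → 𝕜) p.1‖ ^ 2 + ‖(u : X → 𝕜) p.2‖ ^ 2) *
            ((F p.1 - F p.2) ^ 2 / ((n : ℝ) + 1) ^ 2) := by gcongr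
        _ = _ := by
          rw [G.symm p.2 p.1]
          ring
    have h6 : ∑ x ∈ hs.toFinset, cutoff F n x ^ 2 *
        RCLike.re (inner 𝕜 ((u : X → 𝕜) x) (G.lap (u : X → 𝕜) x)) =
        -∑ x ∈ hs.toFinset, cutoff F n x ^ 2 * (μ x * ‖(u : X → 𝕜) x‖ ^ 2) := by
      rw [← Finset.sum_neg_distrib]
      refine Finset.sum_congr rfl fun y _ => ?_
      rw [hlap, ← smul_eq_mul ((-μ y : ℝ) : 𝕜), inner_smul_right, RCLike.re_ofReal_mul,
        inner_self_eq_norm_sq]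
      ring
    have h7 : cutoff F n x ^ 2 * (μ x * ‖(u : X → 𝕜) x‖ ^ 2) ≤
        ∑ x ∈ hs.toFinset, cutoff F n x ^ 2 * (μ x * ‖(u : X → 𝕜) x‖ ^ 2) := by
      have h8 : ∀ y ∈ hs.toFinset, 0 ≤ cutoff F n y ^ 2 * (μ y * ‖(u : X → 𝕜) y‖ ^ 2) :=
        fun y _ => mul_nonneg (sq_nonneg _) (mul_nonneg (μ.pos y).le (sq_nonneg _))
      by_cases hx : x ∈ hs.toFinset
      · exact Finset.single_le_sum h8 hx
      · have hx0 : cutoff F n x = 0 := by simpa using hx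
        rw [hx0, zero_pow two_ne_zero, zero_mul]
        exact Finset.sum_nonneg h8
    rw [h6] at h1
    linarith
  refine Weight.ell2_ext fun x => ?_
  have h1 : Tendsto (fun n : ℕ => S / ((n : ℝ) + 1) ^ 2) atTop (𝓝 0) :=
    Tendsto.div_atTop tendsto_const_nhds ((tendsto_pow_atTop two_ne_zero).comp
      (tendsto_atTop_add_const_right _ _ tendsto_natCast_atTop_atTop))
  have h2 := (((tendsto_cutoff F x).pow 2).mul_const (μ x * ‖(u : X → 𝕜) x‖ ^ 2)).const_mul 2
  have h3 := le_of_tendsto_of_tendsto' h2 h1 fun n => key n x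
  rw [one_pow, one_mul] at h3
  rw [Weight.coe_zero, Pi.zero_apply, ← norm_eq_zero]
  have h4 := μ.pos x
  have h5 : ‖(u : X → 𝕜) x‖ ^ 2 = 0 := by
    refine le_antisymm ?_ (sq_nonneg _)
    by_contra! h6
    nlinarith [mul_pos h4 h6]
  exact pow_eq_zero_iff two_ne_zero |>.mp h5

end WeightedGraph

/-! ## Exhaustions, intrinsic metrics and recurrence -/

namespace WeightedGraph

variable {𝕜 : Type*} [RCLike 𝕜] {X : Type*} {G : WeightedGraph X} {μ : Weight X}

/-- The metric `|F x - F y| + ε x + ε y` off the diagonal. -/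
@[reducible]
noncomputable def perturbedMetric (F ε : X → ℝ) (hε : ∀ x, 0 < ε x) : MetricSpace X :=
  open Classical in
  { dist := fun x y => if x = y then 0 else |F x - F y| + (ε x + ε y)
    dist_self := fun x => if_pos rfl
    dist_comm := fun x y => by
      by_cases h : x = y
      · rw [h]
      · rw [if_neg h, if_neg (Ne.symm h), abs_sub_comm, add_comm (ε x)]
    dist_triangle := fun x y z => by
      have hx := hε x
      have hy := hε y
      have hz := hε z
      have h := abs_sub_le (F x) (F y) (F z)
      have h1 := abs_nonneg (F x - F y)
      have h2 := abs_nonneg (F y - F z)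
      by_cases hxy : x = y
      · rw [hxy, if_pos rfl, zero_add]
      · by_cases hyz : y = z
        · rw [hyz, if_pos rfl, add_zero]
        · rw [if_neg hxy, if_neg hyz]
          split_ifs <;> linarith
    eq_of_dist_eq_zero := fun {x y} h => by
      by_contra hxy
      have h1 : |F x - F y| + (ε x + ε y) = 0 := (if_neg hxy).symm.trans h
      linarith [hε x, hε y, abs_nonneg (F x - F y)] }

theorem perturbedMetric_dist {F ε : X → ℝ} (hε : ∀ x, 0 < ε x) {x y : X} (h : x ≠ y) :
    (perturbedMetric F ε hε).dist x y = |F x - F y| + (ε x + ε y) := if_neg h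

/-- The distance to a base point is 1-Lipschitz, so its energy density is bounded by the summable
weight, and finiteness of balls makes it tend to infinity. -/
theorem exists_tendsToInfinity_of_intrinsic (𝕜 : Type*) [RCLike 𝕜] [Nonempty X]
    (hμ : μ.IsFinite) (ρ : MetricSpace X) (hi : G.IsIntrinsic μ (fun x y => ρ.dist x y))
    (hb : ∀ (x : X) (r : ℝ), {y | ρ.dist x y ≤ r}.Finite) :
    ∃ f : X → 𝕜, f ∈ G.FiniteEnergy ∧ TendsToInfinity f := by
  obtain ⟨o⟩ := ‹Nonempty X›
  have h0 : ∀ p : X × X, 0 ≤ G.b p.1 p.2 * ρ.dist p.1 p.2 ^ 2 :=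
    fun p => mul_nonneg (G.nonneg _ _) (sq_nonneg _)
  have hs : Summable fun p : X × X => G.b p.1 p.2 * ρ.dist p.1 p.2 ^ 2 := by
    refine (summable_prod_of_nonneg h0).mpr ⟨fun x => (hi x).1, ?_⟩
    exact Summable.of_nonneg_of_le (fun x => tsum_nonneg fun y => h0 (x, y))
      (fun x => (hi x).2) (μ.isFinite_iff.mp hμ)
  refine ⟨fun x => (ρ.dist o x : 𝕜), G.mem_finiteEnergy_iff.mpr ?_, fun R => ?_⟩
  · refine Summable.of_nonneg_of_le (fun p => mul_nonneg (G.nonneg _ _) (sq_nonneg _))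
      (fun p => mul_le_mul_of_nonneg_left ?_ (G.nonneg _ _)) hs
    rw [← RCLike.ofReal_sub, RCLike.norm_ofReal]
    refine pow_le_pow_left₀ (abs_nonneg _) ?_ 2
    rw [ρ.dist_comm o, ρ.dist_comm o]
    exact abs_dist_sub_le p.1 p.2 o
  · refine ⟨_, hb o R, fun x hx => ?_⟩
    rw [RCLike.norm_ofReal]
    exact (not_le.mp hx).le.trans (le_abs_self _)

variable [Countable X]

variable (G) in
theorem exists_summable_pos : ∃ c : X → ℝ, (∀ x, 0 < c x) ∧ Summable c ∧
    Summable fun p : X × X => G.b p.1 p.2 * c p.1 := by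
  obtain ⟨ε, hε, s, hs, -⟩ := NNReal.exists_pos_sum_of_countable one_ne_zero X
  have hd : ∀ x, 0 ≤ ∑' y, G.b x y := fun x => tsum_nonneg fun y => G.nonneg x y
  have hε' : Summable fun x => (ε x : ℝ) := NNReal.summable_coe.mpr hs.summable
  have hc : ∀ x, 0 < (ε x : ℝ) / (1 + ∑' y, G.b x y) := fun x =>
    div_pos (hε x) (by linarith [hd x])
  refine ⟨fun x => ε x / (1 + ∑' y, G.b x y), hc, ?_, ?_⟩
  · exact Summable.of_nonneg_of_le (fun x => (hc x).le)
      (fun x => div_le_self (hε x).le (by linarith [hd x])) hε'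
  · have h0 : ∀ p : X × X, 0 ≤ G.b p.1 p.2 * (ε p.1 / (1 + ∑' y, G.b p.1 y)) :=
      fun p => mul_nonneg (G.nonneg _ _) (hc _).le
    refine (summable_prod_of_nonneg h0).mpr
      ⟨fun x => (G.summable x).mul_right (ε x / (1 + ∑' y, G.b x y)), ?_⟩
    refine Summable.of_nonneg_of_le (fun x => tsum_nonneg fun y => h0 (x, y)) (fun x => ?_) hε'
    dsimp only
    rw [tsum_mul_right, mul_div_assoc', div_le_iff₀ (by linarith [hd x]), mul_comm]
    exact mul_le_mul_of_nonneg_left (by linarith) (hε x).le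

theorem IsExhaustion.exists_intrinsic_metric {F : X → ℝ} (hF : G.IsExhaustion F) :
    ∃ μ : Weight X, μ.IsFinite ∧ ∃ ρ : MetricSpace X,
      G.IsIntrinsic μ (fun x y => ρ.dist x y) ∧
      ∀ (x : X) (r : ℝ), {y | ρ.dist x y ≤ r}.Finite := by
  obtain ⟨c, hc, hcs, hcb⟩ := G.exists_summable_pos
  have hε : ∀ x, 0 < √(c x) := fun x => Real.sqrt_pos.mpr (hc x)
  set ρ := perturbedMetric F (fun x => √(c x)) hε
  have hcb' := (Equiv.prodComm X X).summable_iff.mpr hcb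
  have h0 : ∀ p : X × X, 0 ≤ G.b p.1 p.2 * ρ.dist p.1 p.2 ^ 2 :=
    fun p => mul_nonneg (G.nonneg _ _) (sq_nonneg _)
  have hs : Summable fun p : X × X => G.b p.1 p.2 * ρ.dist p.1 p.2 ^ 2 := by
    -- The 3 is from `(a + b + c)² ≤ 3 (a² + b² + c²)` with `b = √(c x)` and `c = √(c y)`.
    refine Summable.of_nonneg_of_le h0 (fun p => ?_)
      (((hF.summable.add hcb).add hcb').mul_left 3)
    obtain ⟨x, y⟩ := p
    simp only [Function.comp_apply, Equiv.prodComm_apply, Prod.swap_prod_mk]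
    by_cases hxy : x = y
    · rw [hxy, G.diag]
      simp
    · rw [perturbedMetric_dist hε hxy, G.symm y x, ← mul_add, ← mul_add, mul_left_comm]
      refine mul_le_mul_of_nonneg_left ?_ (G.nonneg _ _)
      rw [← sq_abs (F x - F y)]
      have h1 := Real.sq_sqrt (hc x).le
      have h2 := Real.sq_sqrt (hc y).le
      nlinarith [sq_nonneg (|F x - F y| - √(c x)), sq_nonneg (|F x - F y| - √(c y)),
        sq_nonneg (√(c x) - √(c y))]
  refine ⟨⟨fun x => c x + ∑' y, G.b x y * ρ.dist x y ^ 2,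
    fun x => add_pos_of_pos_of_nonneg (hc x) (tsum_nonneg fun y => h0 (x, y))⟩, ?_, ρ, ?_, ?_⟩
  · exact (Weight.isFinite_iff _).mpr (hcs.add hs.prod)
  · exact fun x => ⟨hs.prod_factor x, le_add_of_nonneg_left (hc x).le⟩
  · intro x r
    refine ((hF.finite (F x + r + 1)).union (Set.finite_singleton x)).subset fun y hy => ?_
    by_cases hxy : x = y
    · exact Or.inr hxy.symm
    · left
      change ρ.dist x y ≤ r at hy
      rw [perturbedMetric_dist hε hxy] at hy
      change F y < F x + r + 1
      have := neg_abs_le (F x - F y)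
      linarith [hε x, hε y]

theorem IsExhaustion.exists_isEssSelfAdjoint (𝕜 : Type*) [RCLike 𝕜] {F : X → ℝ}
    (hF : G.IsExhaustion F) :
    ∃ μ : Weight X, μ.IsFinite ∧ ∃ h : G.FC μ, IsEssSelfAdjoint (G.Hmin 𝕜 μ h) := by
  obtain ⟨c, hc, hcs, hcb⟩ := G.exists_summable_pos
  have hcb' : Summable fun p : X × X => G.b p.2 p.1 * c p.2 :=
    (Equiv.prodComm X X).summable_iff.mpr hcb
  have h0 : ∀ p : X × X, 0 ≤ G.b p.1 p.2 * (F p.1 - F p.2) ^ 2 :=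
    fun p => mul_nonneg (G.nonneg _ _) (sq_nonneg _)
  have h1 : ∀ p : X × X, 0 ≤ G.b p.2 p.1 * c p.2 := fun p => mul_nonneg (G.nonneg _ _) (hc _).le
  have h2 : ∀ x, 0 ≤ ∑' y, G.b x y * (F x - F y) ^ 2 := fun x => tsum_nonneg fun y => h0 (x, y)
  have h3 : ∀ x, 0 ≤ ∑' y, G.b y x * c y := fun x => tsum_nonneg fun y => h1 (x, y)
  -- The first term gives positivity, the second dominates the energy density of `F`, and the third
  -- yields `b(x, y) c(x) ≤ μ(y)`, so that `b(x, y)² / μ(y) ≤ b(x, y) / c(x)`, which is (FC).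
  let μ : Weight X := ⟨fun x => c x + (∑' y, G.b x y * (F x - F y) ^ 2) + ∑' y, G.b y x * c y,
    fun x => add_pos_of_pos_of_nonneg (add_pos_of_pos_of_nonneg (hc x) (h2 x)) (h3 x)⟩
  have hμ : ∀ x, μ x = c x + (∑' y, G.b x y * (F x - F y) ^ 2) + ∑' y, G.b y x * c y :=
    fun x => rfl
  have hFC : G.FC μ := by
    intro x
    rw [μ.memLp_iff]
    refine Summable.of_nonneg_of_le (fun y => mul_nonneg (μ.pos y).le (sq_nonneg _))
      (fun y => ?_) ((G.summable x).mul_right (c x)⁻¹)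
    have h4 : G.b x y * c x ≤ μ y := by
      have h5 : G.b x y * c x ≤ ∑' z, G.b z y * c z :=
        (hcb'.prod_factor y).le_tsum x fun z _ => h1 (y, z)
      linarith [hμ y, hc y, h2 y]
    have h6 := μ.pos y
    have h7 : μ y * ‖G.b x y / μ y‖ ^ 2 = G.b x y * (G.b x y / μ y) := by
      rw [Real.norm_eq_abs, sq_abs]
      field_simp
    rw [h7]
    refine mul_le_mul_of_nonneg_left ?_ (G.nonneg x y)
    rw [div_le_iff₀ h6, inv_mul_eq_div, le_div_iff₀ (hc x)]
    exact h4
  refine ⟨μ, μ.isFinite_iff.mpr ((hcs.add hF.summable.prod).add hcb'.prod), hFC,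
    hF.isEssSelfAdjoint hFC fun x => ?_⟩
  linarith [hμ x, hc x, h3 x]

theorem exists_tendsToInfinity_of_recurrent
    (h : (fun _ => 1 : X → 𝕜) ∈ G.FiniteEnergyZero) :
    ∃ f : X → 𝕜, f ∈ G.FiniteEnergy ∧ TendsToInfinity f := by
  obtain ⟨-, φ, hfin, hpt, hE⟩ := h
  obtain ⟨e, he⟩ := Countable.exists_injective_nat X
  -- Geometric smallness on finite sets exhausting `X` makes the series of `|1 - φ|` converge
  -- pointwise; geometric smallness of the energy norms makes its energy finite.
  have hn : ∀ k : ℕ, ∃ n, (∀ x ∈ e ⁻¹' Set.Iic k, ‖1 - φ n x‖ < (1 / 2 : ℝ) ^ k) ∧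
      G.energy ((fun _ => 1 : X → 𝕜) - φ n) < ENNReal.ofReal (((1 / 2 : ℝ) ^ k) ^ 2) := by
    intro k
    have hk : (0 : ℝ) < (1 / 2) ^ k := by positivity
    refine Eventually.exists (f := atTop) (Eventually.and ?_ ?_)
    · refine (((Set.finite_Iic k).preimage he.injOn).eventually_all).mpr fun x _ => ?_
      have h1 : Tendsto (fun n => ‖1 - φ n x‖) atTop (𝓝 0) := by
        simpa using ((hpt x).const_sub 1).norm
      exact h1.eventually_lt_const hk
    · exact hE.eventually_lt_const (ENNReal.ofReal_pos.mpr (by positivity))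
  choose n hn1 hn2 using hn
  let r : ℕ → X → ℝ := fun k x => ‖1 - φ (n k) x‖
  have hr0 : ∀ k x, 0 ≤ r k x := fun k x => norm_nonneg _
  have hrs : ∀ x, Summable fun k => r k x := fun x => by
    refine Summable.of_norm_bounded_eventually_nat summable_geometric_two ?_
    filter_upwards [eventually_ge_atTop (e x)] with k hk
    rw [Real.norm_of_nonneg (hr0 k x)]
    exact (hn1 k x hk).le
  let ψ : ℕ → X → 𝕜 := fun k x => (r k x : 𝕜)
  have hψ : ∀ k, G.energy (ψ k) ≤ ENNReal.ofReal (((1 / 2 : ℝ) ^ k) ^ 2) := fun k => by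
    have hL : LipschitzWith 1 fun z : 𝕜 => ((‖z‖ : ℝ) : 𝕜) :=
      LipschitzWith.of_dist_le_mul fun a b => by
        rw [NNReal.coe_one, one_mul, dist_eq_norm, dist_eq_norm, ← RCLike.ofReal_sub,
          RCLike.norm_ofReal]
        exact abs_norm_sub_norm_le a b
    exact (energy_comp_le hL _).trans (hn2 k).le
  have hmem : ∀ k, Memℓp (G.gradFun (ψ k)) 2 := fun k =>
    G.memℓp_gradFun_iff.mpr ((hψ k).trans_lt ENNReal.ofReal_lt_top)
  let E : ℕ → lp (fun _ : X × X => 𝕜) 2 := fun k => ⟨_, hmem k⟩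
  have hEn : ∀ k, ‖E k‖ ≤ (1 / 2 : ℝ) ^ k := fun k => by
    have h1 := hψ k
    rw [energy_eq_ofReal_norm_sq (k := E k) rfl,
      ENNReal.ofReal_le_ofReal_iff (by positivity)] at h1
    exact le_of_sq_le_sq h1 (by positivity)
  have hEs : ∀ N, ⇑(∑ k ∈ Finset.range N, E k) =
      G.gradFun (∑ k ∈ Finset.range N, ψ k) := fun N => by
    induction N with
    | zero => rw [Finset.sum_range_zero, Finset.sum_range_zero, gradFun_zero, lp.coeFn_zero]
    | succ N ih =>
      rw [Finset.sum_range_succ, Finset.sum_range_succ, gradFun_add, lp.coeFn_add, ih]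
  refine ⟨fun x => ((∑' k, r k x : ℝ) : 𝕜), ?_, fun R => ?_⟩
  · refine (energy_le_of_tendsto (u := fun N => ∑ k ∈ Finset.range N, ψ k)
      (C := ENNReal.ofReal (2 ^ 2)) (fun x => ?_) fun N => ?_).trans_lt ENNReal.ofReal_lt_top
    · have h1 := ((RCLike.continuous_ofReal (K := 𝕜)).tendsto _).comp
        (hrs x).hasSum.tendsto_sum_nat
      refine h1.congr fun N => ?_
      rw [Function.comp_apply, Finset.sum_apply, RCLike.ofReal_sum]
    · rw [energy_eq_ofReal_norm_sq (hEs N)]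
      refine ENNReal.ofReal_le_ofReal (pow_le_pow_left₀ (norm_nonneg _) ?_ 2)
      exact (norm_sum_le _ _).trans
        ((Finset.sum_le_sum fun k _ => hEn k).trans (sum_geometric_two_le N))
  -- Off these supports each of the first `⌈R⌉₊` summands equals 1, and absolute values prevent
  -- cancellation by the others.
  · refine ⟨⋃ k ∈ Finset.range ⌈R⌉₊, Function.support (φ (n k)),
      (Finset.range ⌈R⌉₊).finite_toSet.biUnion fun k _ => hfin _, fun x hx => ?_⟩
    have h1 : ∀ k ∈ Finset.range ⌈R⌉₊, r k x = 1 := fun k hk => by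
      have : φ (n k) x = 0 := by
        by_contra h
        exact hx (Set.mem_biUnion hk h)
      simp [r, this]
    have h2 := (hrs x).sum_le_tsum (Finset.range ⌈R⌉₊) fun k _ => hr0 k x
    rw [Finset.sum_congr rfl h1, Finset.sum_const, Finset.card_range, nsmul_one] at h2
    rw [RCLike.norm_ofReal]
    exact (Nat.le_ceil R).trans (h2.trans (le_abs_self _))

theorem recurrent_of_mem_domain_gradMin {f : Ell2 𝕜 μ} (hf : (f : X → 𝕜) = fun _ => 1)
    (h : f ∈ (G.gradMin 𝕜 μ).domain) : (fun _ => 1 : X → 𝕜) ∈ G.FiniteEnergyZero := by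
  have hk := (G.gradMin 𝕜 μ).mem_graph ⟨f, h⟩
  obtain ⟨u, l, hus, hul, hu1, hlk⟩ := exists_seq_of_mem_graph_gradMin hk
  have hk' := LinearPMap.le_graph_of_le gradMin_le_grad hk
  refine ⟨?_, fun n => (u n : X → 𝕜), hus, fun x => ?_, ?_⟩
  · have := LinearPMap.mem_domain_of_mem_graph hk'
    rwa [mem_domain_grad, hf] at this
  · have := Weight.tendsto_apply hu1 x
    rwa [hf] at this
  · have h3 := ENNReal.tendsto_ofReal ((hlk.const_sub (G.gradMin 𝕜 μ ⟨f, h⟩)).norm.pow 2)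
    rw [sub_self, norm_zero, zero_pow two_ne_zero, ENNReal.ofReal_zero] at h3
    refine h3.congr fun n => ?_
    have h4 : (f - u n, G.gradMin 𝕜 μ ⟨f, h⟩ - l n) ∈ (G.grad 𝕜 μ).graph :=
      Submodule.sub_mem _ hk' (hul n)
    rw [ofReal_norm_sq_eq_energy h4, Weight.coe_sub, hf]

/-- Markov uniqueness for a finite weight implies recurrence. -/
theorem recurrent_of_unique (hμ : μ.IsFinite)
    (hu : ∃! M : Ell2 𝕜 μ →ₗ.[𝕜] Ell2 𝕜 μ, G.IsMarkovianRealization μ M) :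
    (fun _ => 1 : X → 𝕜) ∈ G.FiniteEnergyZero := by
  have hone : MemLp (fun _ => 1 : X → 𝕜) 2 μ.measure := by
    rw [μ.memLp_iff]
    simpa using μ.isFinite_iff.mp hμ
  obtain ⟨f, hf⟩ : ∃ f : Ell2 𝕜 μ, (f : X → 𝕜) = fun _ => 1 := ⟨_, Weight.coe_toLp hone⟩
  have h1 : (f, (0 : lp (fun _ : X × X => 𝕜) 2)) ∈ (G.grad 𝕜 μ).graph := by
    rw [mem_graph_grad, hf, gradFun_one, lp.coeFn_zero]
  -- The constant 1 is harmonic for the maximal form; uniqueness transfers it to the operator of the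
  -- minimal form, and thus to the minimal domain.
  have h2 : (f, (0 : Ell2 𝕜 μ)) ∈ (G.grad 𝕜 μ).square.graph := by
    rw [LinearPMap.graph_square (Weight.dense_finSupp.mono finSupp_le_domain_grad)]
    exact ⟨0, h1, fun r _ => by rw [inner_zero_left, inner_zero_left]⟩
  rw [hu.unique (isMarkovianRealization_square_grad 𝕜 G μ)
    (isMarkovianRealization_square_gradMin 𝕜 G μ),
    LinearPMap.graph_square (Weight.dense_finSupp.mono finSupp_le_domain_gradMin)] at h2
  obtain ⟨k, hk, -⟩ := h2
  exact recurrent_of_mem_domain_gradMin hf (LinearPMap.mem_domain_of_mem_graph hk)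

end WeightedGraph

/-! ### The equivalences -/

theorem mainTheorem13 (𝕜 : Type*) [RCLike 𝕜] {X : Type*} [Countable X] [Nonempty X]
    (G : WeightedGraph X) :
    List.TFAE [
      ∃ μ : Weight X, μ.IsFinite ∧
        ∃! M : Ell2 𝕜 μ →ₗ.[𝕜] Ell2 𝕜 μ, G.IsMarkovianRealization μ M,
      ∀ μ : Weight X, μ.IsFinite →
        ∃! M : Ell2 𝕜 μ →ₗ.[𝕜] Ell2 𝕜 μ, G.IsMarkovianRealization μ M,
      ∃ μ : Weight X, μ.IsFinite ∧
        ∃! M : Ell2 𝕜 μ →ₗ.[𝕜] Ell2 𝕜 μ, G.IsRealization μ M,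
      ∃ μ : Weight X, μ.IsFinite ∧ ∃ ρ : MetricSpace X,
        G.IsIntrinsic μ (fun x y => ρ.dist x y) ∧
        ∀ (x : X) (r : ℝ), {y | ρ.dist x y ≤ r}.Finite,
      (fun _ => 1 : X → 𝕜) ∈ G.FiniteEnergyZero,
      ∃ f : X → 𝕜, f ∈ G.FiniteEnergy ∧ TendsToInfinity f,
      ∃ μ : Weight X, μ.IsFinite ∧ ∃ h : G.FC μ, IsEssSelfAdjoint (G.Hmin 𝕜 μ h)] := by
  have ex : ∀ f : X → 𝕜, f ∈ G.FiniteEnergy ∧ TendsToInfinity f → ∃ F, G.IsExhaustion F :=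
    fun f hf => WeightedGraph.exists_isExhaustion hf.1 hf.2
  tfae_have 5 → 6 := WeightedGraph.exists_tendsToInfinity_of_recurrent
  tfae_have 6 → 5 := by
    rintro ⟨f, hf⟩
    obtain ⟨F, hF⟩ := ex f hf
    exact hF.one_mem_finiteEnergyZero
  tfae_have 6 → 4 := by
    rintro ⟨f, hf⟩
    obtain ⟨F, hF⟩ := ex f hf
    exact hF.exists_intrinsic_metric
  tfae_have 4 → 6 := by
    rintro ⟨μ, hμ, ρ, hi, hb⟩
    exact WeightedGraph.exists_tendsToInfinity_of_intrinsic 𝕜 hμ ρ hi hb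
  tfae_have 6 → 7 := by
    rintro ⟨f, hf⟩
    obtain ⟨F, hF⟩ := ex f hf
    exact hF.exists_isEssSelfAdjoint 𝕜
  tfae_have 7 → 3 := by
    rintro ⟨μ, hμ, h, hs⟩
    exact ⟨μ, hμ, WeightedGraph.existsUnique_isRealization hs⟩
  tfae_have 3 → 1 := by
    rintro ⟨μ, hμ, hu⟩
    exact ⟨μ, hμ, _, WeightedGraph.isMarkovianRealization_square_grad 𝕜 G μ,
      fun M hM => hu.unique hM.1 (WeightedGraph.isMarkovianRealization_square_grad 𝕜 G μ).1⟩
  tfae_have 1 → 5 := by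
    rintro ⟨μ, hμ, hu⟩
    exact WeightedGraph.recurrent_of_unique hμ hu
  tfae_have 6 → 2 := by
    rintro ⟨f, hf⟩ μ -
    obtain ⟨F, hF⟩ := ex f hf
    exact hF.existsUnique_isMarkovianRealization μ
  tfae_have 2 → 1 := by
    intro h
    -- A universal statement over finite weights yields an existential one only because a finite
    -- weight exists, by countability.
    obtain ⟨c, hc, hcs, -⟩ := G.exists_summable_pos
    have hμ := (Weight.isFinite_iff ⟨c, hc⟩).mpr hcs
    exact ⟨_, hμ, h _ hμ⟩
  tfae_finish
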